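/- Let $D$ be a connected $C^\infty$ orbifold (effective: locally $D$ is a quotient $\tilde U/\Gamma$ of a connected manifold $\tilde U$ by a finite group $\Gamma$ acting smoothly and effectively). Let $p\colon N\to D$ and $Q\to D$ be $C^\infty$ complex orbifold line bundles. Let $L=\{v\in N : |v|=1\}$ be the unit circle bundle of $N$ with respect to some $C^\infty$ Hermitian metric on $N$, with its induced structure of a $C^\infty$ orbifold: over a uniformizing chart $\tilde U\to \tilde U/\Gamma$ of $D$ that trivializes $N$, one has $L=(\tilde U\times S^1)/\Gamma$. Let $(p|_L)^*Q$ be the pullback of $Q$ to $L$, i.e. the orbifold line bundle with local form $(\tilde U\times S^1\times\mathbb C)/\Gamma$ over uniformizing charts that trivialize both $N$ and $Q$, whose transition functions are those of $Q$ pulled back under the projections $\tilde U\times S^1\to\tilde U$. Then $(p|_L)^*Q$ is trivial as a $C^\infty$ complex orbifold line bundle on $L$ if and only if $Q$ is isomorphic to $N^{-\alpha}$ as a $C^\infty$ complex orbifold line bundle on $D$ for some $\alpha\in\mathbb Z$. -/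

import Mathlib

open Set Filter Topology Manifold
open scoped ContDiff

universe u

noncomputable section

/-! ### Rigidity of finite group actions

Helper facts: a finite order diffeomorphism which is tangent to the identity at a fixed point is
the identity nearby. This is what makes the unit circle bundle an orbifold again and makes
coordinate changes act on line orbibundles unambiguously. -/

section Rigidity

variable {E : Type*} [NormedAddCommGroup E] [NormedSpace ℝ E]
  {H : Type*} [TopologicalSpace H] {I : ModelWithCorners ℝ E H}
  {M : Type*} [TopologicalSpace M] [ChartedSpace H M]

theorem contDiffAt_conj [I.Boundaryless] {f : M → M} {x : M} (hx : f x = x)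
    (hf : ContMDiffAt I I ∞ f x) :
    ContDiffAt ℝ ∞ (extChartAt I x ∘ f ∘ (extChartAt I x).symm) (extChartAt I x x) := by
  have := (contMDiffAt_iff.1 hf).2
  rwa [hx, I.range_eq_univ, contDiffWithinAt_univ] at this

theorem fderiv_conj_eq [I.Boundaryless] {f g : M → M} {x : M} (hfx : f x = x) (hgx : g x = x)
    (hf : ContMDiffAt I I ∞ f x) (hg : ContMDiffAt I I ∞ g x)
    (hfg : ∃ᶠ p in 𝓝 x, f =ᶠ[𝓝 p] g) :
    fderiv ℝ (extChartAt I x ∘ f ∘ (extChartAt I x).symm) (extChartAt I x x) =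
      fderiv ℝ (extChartAt I x ∘ g ∘ (extChartAt I x).symm) (extChartAt I x x) := by
  have cf := (contDiffAt_conj hfx hf).continuousAt_fderiv (by simp)
  have cg := (contDiffAt_conj hgx hg).continuousAt_fderiv (by simp)
  have key : ∃ᶠ p in 𝓝 x, fderiv ℝ (extChartAt I x ∘ f ∘ (extChartAt I x).symm) (extChartAt I x p) =
      fderiv ℝ (extChartAt I x ∘ g ∘ (extChartAt I x).symm) (extChartAt I x p) := by
    refine (hfg.and_eventually (extChartAt_source_mem_nhds (I := I) x)).mono ?_
    rintro p ⟨hp, hps⟩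
    apply Filter.EventuallyEq.fderiv_eq
    have hc : Tendsto (extChartAt I x).symm (𝓝 (extChartAt I x p)) (𝓝 p) := by
      have := continuousAt_extChartAt_symm' (I := I) hps
      rwa [ContinuousAt, (extChartAt I x).left_inv hps] at this
    filter_upwards [hc.eventually hp] with q hq
    simp only [Function.comp_apply, hq]
  have cx : ContinuousAt (extChartAt I x) x := continuousAt_extChartAt x
  have tf : Tendsto (fun p => fderiv ℝ (extChartAt I x ∘ f ∘ (extChartAt I x).symm)
      (extChartAt I x p) - fderiv ℝ (extChartAt I x ∘ g ∘ (extChartAt I x).symm)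
      (extChartAt I x p)) (𝓝 x) (𝓝 (fderiv ℝ (extChartAt I x ∘ f ∘ (extChartAt I x).symm)
      (extChartAt I x x) - fderiv ℝ (extChartAt I x ∘ g ∘ (extChartAt I x).symm)
      (extChartAt I x x))) :=
    (cf.tendsto.comp cx).sub (cg.tendsto.comp cx)
  have h0 : fderiv ℝ (extChartAt I x ∘ f ∘ (extChartAt I x).symm)
      (extChartAt I x x) - fderiv ℝ (extChartAt I x ∘ g ∘ (extChartAt I x).symm)
      (extChartAt I x x) ∈ ({0} : Set (E →L[ℝ] E)) :=
    isClosed_singleton.mem_of_frequently_of_tendsto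
      (key.mono fun p hp => sub_eq_zero.2 hp) tf
  exact sub_eq_zero.1 h0

variable {G : Type*} [Group G] [Finite G] [MulAction G M]

theorem smul_eq_near_of_fderiv_eq_id [I.Boundaryless] [CompleteSpace E]
    (hs : ∀ γ : G, ContMDiff I I ∞ (fun p : M => γ • p)) {γ : G} {x : M} (hx : γ • x = x)
    (hd : fderiv ℝ (extChartAt I x ∘ (fun p : M => γ • p) ∘ (extChartAt I x).symm)
      (extChartAt I x x) = ContinuousLinearMap.id ℝ E) :
    ∀ᶠ p in 𝓝 x, γ • p = p := by
  set φ := extChartAt I x with hφ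
  have hpow : ∀ k : ℕ, γ ^ k • x = x := by
    intro k
    induction k with
    | zero => simp
    | succ k ih => rw [pow_succ, mul_smul, hx, ih]
  set K : ℕ → E → E := fun k => φ ∘ (fun p : M => γ ^ k • p) ∘ φ.symm with hK
  have hKs : ∀ k, ContDiffAt ℝ ∞ (K k) (φ x) := fun k =>
    contDiffAt_conj (I := I) (f := fun p : M => γ ^ k • p) (hpow k) (hs (γ ^ k) x)
  have hKstrict : ∀ k, HasStrictFDerivAt (K k) (fderiv ℝ (K k) (φ x)) (φ x) := fun k =>
    (hKs k).hasStrictFDerivAt (by simp)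
  have hKx : ∀ k, K k (φ x) = φ x := by
    intro k
    simp only [hK, Function.comp]
    rw [hφ, extChartAt_to_inv, hpow]
  have hsrc : ∀ᶠ q in 𝓝 (φ x), φ.symm q ∈ φ.source ∧ γ • φ.symm q ∈ φ.source := by
    have h1 : ContinuousAt φ.symm (φ x) := continuousAt_extChartAt_symm x
    have h1' : Tendsto φ.symm (𝓝 (φ x)) (𝓝 x) := by
      have := h1.tendsto; rwa [hφ, extChartAt_to_inv] at this
    have h2 : Tendsto (fun p : M => γ • p) (𝓝 x) (𝓝 x) := by
      have := ((hs γ).continuous.tendsto x); rwa [hx] at this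
    have hn := extChartAt_source_mem_nhds (I := I) x
    exact (h1'.eventually hn).and ((h2.comp h1').eventually hn)
  have hKsucc : ∀ k, K (k + 1) =ᶠ[𝓝 (φ x)] K k ∘ K 1 := by
    intro k
    filter_upwards [hsrc] with q hq
    simp only [hK, Function.comp, pow_one]
    rw [φ.left_inv hq.2, pow_succ, mul_smul]
  have hd1 : HasFDerivAt (K 1) (ContinuousLinearMap.id ℝ E) (φ x) := by
    have := (hKstrict 1).hasFDerivAt
    have h2 : fderiv ℝ (K 1) (φ x) = ContinuousLinearMap.id ℝ E := by
      rw [← hd]; simp only [hK, pow_one]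
    rwa [h2] at this
  have hder : ∀ k, fderiv ℝ (K k) (φ x) = ContinuousLinearMap.id ℝ E := by
    intro k
    induction k with
    | zero =>
      have : K 0 =ᶠ[𝓝 (φ x)] id := by
        filter_upwards [extChartAt_target_mem_nhds (I := I) x] with q hq
        simp only [hK, Function.comp, pow_zero, one_smul]
        exact φ.right_inv hq
      rw [this.fderiv_eq, fderiv_id]
    | succ k ih =>
      rw [(hKsucc k).fderiv_eq]
      have h1 : HasFDerivAt (K k) (ContinuousLinearMap.id ℝ E) (K 1 (φ x)) := by
        rw [hKx, ← ih]; exact (hKstrict k).hasFDerivAt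
      have := (h1.comp _ hd1).fderiv
      rw [this]; simp
  -- the average over the cyclic group generated by `γ`
  set m := orderOf γ with hm
  have hmpos : 0 < m := orderOf_pos γ
  set F : E → E := fun q => ∑ k ∈ Finset.range m, K k q with hF
  have hFd : HasStrictFDerivAt F (∑ _k ∈ Finset.range m, ContinuousLinearMap.id ℝ E) (φ x) := by
    apply HasStrictFDerivAt.fun_sum
    intro k _
    rw [← hder k]; exact hKstrict k
  set e : E ≃L[ℝ] E := ContinuousLinearEquiv.smulLeft (Units.mk0 (m : ℝ) (by positivity)) with he
  have hFd' : HasStrictFDerivAt F (e : E →L[ℝ] E) (φ x) := by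
    convert hFd using 1
    ext v
    simp [he, Units.smul_def, ← Nat.cast_smul_eq_nsmul ℝ]
  have hinj : ∃ U ∈ 𝓝 (φ x), InjOn F U :=
    ⟨_, (hFd'.toOpenPartialHomeomorph F).open_source.mem_nhds
      hFd'.mem_toOpenPartialHomeomorph_source, (hFd'.toOpenPartialHomeomorph F).injOn⟩
  obtain ⟨U, hU, hinj⟩ := hinj
  have hFinv : ∀ᶠ q in 𝓝 (φ x), F (K 1 q) = F q := by
    have hall : ∀ᶠ q in 𝓝 (φ x), ∀ k ∈ Finset.range m, K (k + 1) q = K k (K 1 q) :=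
      (Finset.eventually_all _).2 fun k _ => hKsucc k
    filter_upwards [hall] with q hq
    simp only [hF]
    rw [← Finset.sum_congr rfl hq]
    have h1 := Finset.sum_range_succ (fun k => K k q) m
    have h2 := Finset.sum_range_succ' (fun k => K k q) m
    have h3 : K m q = K 0 q := by
      simp only [hK, hm, pow_orderOf_eq_one, pow_zero]
    rw [h1, h3] at h2
    exact (add_right_cancel h2).symm
  have hcx : Tendsto φ (𝓝 x) (𝓝 (φ x)) := continuousAt_extChartAt x
  have h2 : Tendsto (fun p : M => γ • p) (𝓝 x) (𝓝 x) := by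
    have := ((hs γ).continuous.tendsto x); rwa [hx] at this
  have hn := extChartAt_source_mem_nhds (I := I) x
  filter_upwards [hcx.eventually hFinv, hcx.eventually hU, (hcx.comp h2).eventually hU, hn,
    h2.eventually hn] with p hp1 hp2 hp3 hp4 hp5
  have hK1 : K 1 (φ p) = φ (γ • p) := by
    simp only [hK, Function.comp, pow_one]; rw [φ.left_inv hp4]
  rw [hK1] at hp1
  exact φ.injOn hp5 hp4 (hinj hp3 hp2 hp1)

theorem smul_eq_self_of_fderiv_eq_id [I.Boundaryless] [CompleteSpace E] [ConnectedSpace M]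
    [T2Space M]
    (hs : ∀ γ : G, ContMDiff I I ∞ (fun p : M => γ • p)) {γ : G} {x : M} (hx : γ • x = x)
    (hd : fderiv ℝ (extChartAt I x ∘ (fun p : M => γ • p) ∘ (extChartAt I x).symm)
      (extChartAt I x x) = ContinuousLinearMap.id ℝ E) (p : M) :
    γ • p = p := by
  set S : Set M := {p | ∀ᶠ q in 𝓝 p, γ • q = q} with hS
  have hSo : IsOpen S := isOpen_iff_mem_nhds.2 fun p hp => (eventually_eventually_nhds.2 hp)
  have hSc : IsClosed S := by
    rw [isClosed_iff_frequently]
    intro y hy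
    have hfix : γ • y = y := by
      have hcl : IsClosed {q : M | γ • q = q} := isClosed_eq (hs γ).continuous continuous_id
      exact hcl.mem_of_frequently_of_tendsto (hy.mono fun q hq => hq.self_of_nhds) tendsto_id
    refine smul_eq_near_of_fderiv_eq_id hs hfix ?_
    have h1 := fderiv_conj_eq (I := I) (f := fun p : M => γ • p) (g := id) (x := y) hfix rfl
      (hs γ y) contMDiffAt_id hy
    rw [h1]
    have : (extChartAt I y ∘ id ∘ (extChartAt I y).symm) =ᶠ[𝓝 (extChartAt I y y)] id := by
      filter_upwards [extChartAt_target_mem_nhds (I := I) y] with q hq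
      exact (extChartAt I y).right_inv hq
    rw [this.fderiv_eq, fderiv_id]
  have hSu : S = univ := IsClopen.eq_univ ⟨hSc, hSo⟩ ⟨x, smul_eq_near_of_fderiv_eq_id hs hx hd⟩
  have : p ∈ S := hSu ▸ mem_univ p
  exact this.self_of_nhds

/-- A smooth local map which moves every point inside its orbit under a finite effective group of
diffeomorphisms of a connected manifold locally agrees with a group element. -/
theorem eventuallyEq_smul_of_mem_orbit [I.Boundaryless] [CompleteSpace E] [ConnectedSpace M]
    [T2Space M] [FaithfulSMul G M]
    (hs : ∀ γ : G, ContMDiff I I ∞ (fun p : M => γ • p)) {h : M → M} {W : Set M} (hW : IsOpen W)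
    (hh : ContMDiffOn I I ∞ h W) (horb : ∀ p ∈ W, ∃ γ : G, h p = γ • p) {x : M} (hx : x ∈ W) :
    ∃ γ : G, h =ᶠ[𝓝 x] fun p => γ • p := by
  have hcont : ContinuousOn h W := hh.continuousOn
  -- finite sets of group elements can be avoided on small open sets
  have claim : ∀ (S : Finset G) (V : Set M), IsOpen V → V.Nonempty → V ⊆ W →
      (∀ γ ∈ S, ∀ p ∈ V, ¬ h =ᶠ[𝓝 p] fun q => γ • q) →
      ∃ V' ⊆ V, IsOpen V' ∧ V'.Nonempty ∧ ∀ γ ∈ S, ∀ p ∈ V', h p ≠ γ • p := by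
    classical
    intro S
    induction S using Finset.induction_on with
    | empty => intro V h1 h2 _ _; exact ⟨V, subset_rfl, h1, h2, by simp⟩
    | insert δ S _ ih =>
      intro V hVo hVn hVW hV
      obtain ⟨V', hsub, ho, hne, hav⟩ := ih V hVo hVn hVW
        fun γ hγ => hV γ (Finset.mem_insert_of_mem hγ)
      refine ⟨{p ∈ V' | h p ≠ δ • p}, fun p hp => hsub hp.1, ?_, ?_, ?_⟩
      · have : {p ∈ V' | h p ≠ δ • p} = V' ∩ (fun p => (h p, δ • p)) ⁻¹' (diagonal M)ᶜ := by
          ext p; simp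
        rw [this]
        exact ((hcont.mono (hsub.trans hVW)).prodMk
          (hs δ).continuous.continuousOn).isOpen_inter_preimage ho isClosed_diagonal.isOpen_compl
      · by_contra hemp
        obtain ⟨p, hp⟩ := hne
        refine hV δ (Finset.mem_insert_self _ _) p (hsub hp) ?_
        filter_upwards [ho.mem_nhds hp] with q hq
        by_contra hne
        exact hemp ⟨q, hq, hne⟩
      · intro γ hγ p hp
        rcases Finset.mem_insert.1 hγ with rfl | hγ
        · exact hp.2
        · exact hav γ hγ p hp.1
  have : Fintype G := Fintype.ofFinite G
  classical
  -- some group element agrees with `h` on open sets accumulating at `x`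
  obtain ⟨γ, hγ⟩ : ∃ γ : G, ∃ᶠ p in 𝓝 x, h =ᶠ[𝓝 p] fun q => γ • q := by
    by_contra hcon
    push Not at hcon
    have : ∀ᶠ p in 𝓝 x, p ∈ W ∧ ∀ γ : G, ¬ h =ᶠ[𝓝 p] fun q => γ • q :=
      Filter.Eventually.and (hW.mem_nhds hx) (eventually_all.2 fun γ => by simpa using hcon γ)
    obtain ⟨V, hV, hVo, hxV⟩ := eventually_nhds_iff.1 this
    obtain ⟨V', hsub, _, ⟨p, hp⟩, hav⟩ := claim Finset.univ V hVo ⟨x, hxV⟩ (fun p hp => (hV p hp).1)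
      fun γ _ p hp => (hV p hp).2 γ
    obtain ⟨γ, hγ⟩ := horb p (hV p (hsub hp)).1
    exact hav γ (Finset.mem_univ _) p hp hγ
  have hval : ∀ δ : G, (∃ᶠ p in 𝓝 x, h =ᶠ[𝓝 p] fun q => δ • q) → h x = δ • x := by
    intro δ hδ
    have t : Tendsto (fun p => (h p, δ • p)) (𝓝 x) (𝓝 (h x, δ • x)) :=
      (hcont.continuousAt (hW.mem_nhds hx)).prodMk_nhds (hs δ).continuous.continuousAt
    exact isClosed_diagonal.mem_of_frequently_of_tendsto (hδ.mono fun p hp => hp.self_of_nhds) t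
  -- this group element is unique
  have huniq : ∀ δ : G, (∃ᶠ p in 𝓝 x, h =ᶠ[𝓝 p] fun q => δ • q) → δ = γ := by
    intro δ hδ
    have hxγ : γ⁻¹ • h x = x := by rw [hval γ hγ, inv_smul_smul]
    have hxδ : (γ⁻¹ * δ) • x = x := by rw [mul_smul, ← hval δ hδ, hxγ]
    have hk : ContMDiffAt I I ∞ (fun p => γ⁻¹ • h p) x :=
      (hs γ⁻¹ (h x)).comp x (hh.contMDiffAt (hW.mem_nhds hx))
    have h1 := fderiv_conj_eq (I := I) (f := fun p => γ⁻¹ • h p) (g := fun p => (γ⁻¹ * δ) • p)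
      hxγ hxδ hk (hs _ x) (hδ.mono fun p hp => by
        filter_upwards [hp] with q hq
        rw [hq, mul_smul])
    have h2 := fderiv_conj_eq (I := I) (f := fun p => γ⁻¹ • h p) (g := fun p => (1 : G) • p)
      hxγ (one_smul _ _) hk (hs _ x) (hγ.mono fun p hp => by
        filter_upwards [hp] with q hq
        rw [hq, one_smul, inv_smul_smul])
    have h3 : fderiv ℝ (extChartAt I x ∘ (fun p : M => (1 : G) • p) ∘ (extChartAt I x).symm)
        (extChartAt I x x) = ContinuousLinearMap.id ℝ E := by
      have : (extChartAt I x ∘ (fun p : M => (1 : G) • p) ∘ (extChartAt I x).symm)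
          =ᶠ[𝓝 (extChartAt I x x)] id := by
        filter_upwards [extChartAt_target_mem_nhds (I := I) x] with q hq
        simp only [Function.comp, one_smul]
        exact (extChartAt I x).right_inv hq
      rw [this.fderiv_eq, fderiv_id]
    have h4 : γ⁻¹ * δ = 1 := by
      apply FaithfulSMul.eq_of_smul_eq_smul (α := M)
      intro p
      rw [one_smul]
      exact smul_eq_self_of_fderiv_eq_id hs hxδ (h1.symm.trans (h2.trans h3)) p
    exact (inv_mul_eq_one.1 h4).symm
  refine ⟨γ, ?_⟩
  have hev : ∀ᶠ p in 𝓝 x, p ∈ W ∧ ∀ δ : G, δ ≠ γ → ¬ h =ᶠ[𝓝 p] fun q => δ • q := by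
    refine Filter.Eventually.and (hW.mem_nhds hx) (eventually_all.2 fun δ => ?_)
    by_cases hδ : δ = γ
    · simp [hδ]
    · have := mt (huniq δ) hδ
      exact (Filter.not_frequently.1 this).mono fun p hp _ => hp
  obtain ⟨V, hV, hVo, hxV⟩ := eventually_nhds_iff.1 hev
  filter_upwards [hVo.mem_nhds hxV] with p hp
  by_contra hne
  have ho2 : IsOpen {q ∈ V | h q ≠ γ • q} := by
    have : {q ∈ V | h q ≠ γ • q} = V ∩ (fun q => (h q, γ • q)) ⁻¹' (diagonal M)ᶜ := by
      ext q; simp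
    rw [this]
    exact ((hcont.mono fun q hq => (hV q hq).1).prodMk
      (hs γ).continuous.continuousOn).isOpen_inter_preimage hVo isClosed_diagonal.isOpen_compl
  obtain ⟨V', hsub, _, ⟨q, hq⟩, hav⟩ := claim (Finset.univ.erase γ) _ ho2 ⟨p, hp, hne⟩
    (fun q hq => (hV q hq.1).1) fun δ hδ q hq => (hV q hq.1).2 δ (Finset.ne_of_mem_erase hδ)
  obtain ⟨δ, hδ⟩ := horb q (hV q (hsub hq).1).1
  by_cases h5 : δ = γ
  · exact (hsub hq).2 (h5 ▸ hδ)
  · exact hav δ (Finset.mem_erase.2 ⟨h5, Finset.mem_univ _⟩) q hq hδ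

end Rigidity


/-! ### The phase of a nonzero complex number -/

section Phase

/-- The phase `w / |w|` of a nonzero complex number, as a point of the unit circle. -/
def phase (w : ℂ) : Circle := Circle.exp (Complex.arg w)

theorem norm_mul_phase (w : ℂ) : (‖w‖ : ℂ) * (phase w : ℂ) = w := by
  rw [phase, Circle.coe_exp]
  exact Complex.norm_mul_exp_arg_mul_I w

theorem phase_eq_of_norm_mul {w : ℂ} {r : ℝ} {z : Circle} (hr : 0 < r) (h : w = r * (z : ℂ)) :
    phase w = z := by
  have h1 : ‖w‖ = r := by rw [h, norm_mul, Circle.norm_coe, mul_one, Complex.norm_real, Real.norm_of_nonneg hr.le]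
  have h2 := norm_mul_phase w
  rw [h1] at h2
  nth_rewrite 2 [h] at h2
  have hr' : (r : ℂ) ≠ 0 := by exact_mod_cast hr.ne'
  exact Circle.ext (mul_left_cancel₀ hr' h2)

theorem phase_mul {a b : ℂ} (ha : a ≠ 0) (hb : b ≠ 0) : phase (a * b) = phase a * phase b := by
  apply phase_eq_of_norm_mul (r := ‖a‖ * ‖b‖) (by positivity)
  conv_lhs => rw [← norm_mul_phase a, ← norm_mul_phase b]
  push_cast
  ring

theorem phase_one : phase 1 = 1 :=
  phase_eq_of_norm_mul one_pos (by simp)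

theorem contMDiffAt_phase {w : ℂ} (hw : w ≠ 0) : ContMDiffAt 𝓘(ℝ, ℂ) (𝓡 1) ∞ phase w := by
  have h1 : ContDiffAt ℝ ∞ (fun v : ℂ => (Complex.log (v / w)).im) w := by
    have h2 : ContDiffAt ℝ ∞ (fun v : ℂ => v / w) w := contDiffAt_id.div_const w
    have h3 : ContDiffAt ℝ ∞ Complex.log (w / w) := by
      rw [div_self hw]
      exact (Complex.contDiffAt_log Complex.one_mem_slitPlane).restrict_scalars ℝ
    exact Complex.imCLM.contDiff.contDiffAt.comp w (ContDiffAt.comp (f := fun v : ℂ => v / w) w h3 h2)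
  have h4 : ContMDiffAt 𝓘(ℝ, ℂ) (𝓡 1) ∞
      (fun v : ℂ => phase w * Circle.exp (Complex.log (v / w)).im) w := by
    have h5 : ContMDiffAt 𝓘(ℝ, ℂ) (𝓡 1) ∞
        (fun v : ℂ => Circle.exp (Complex.log (v / w)).im) w :=
      (contMDiff_circleExp (m := ∞)).contMDiffAt.comp w h1.contMDiffAt
    exact contMDiffAt_const.mul h5
  refine h4.congr_of_eventuallyEq ?_
  filter_upwards [isOpen_ne.mem_nhds hw] with v hv
  have hvw : v / w ≠ 0 := div_ne_zero hv hw
  have : v = w * (v / w) := by field_simp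
  conv_lhs => rw [this, phase_mul hw hvw]
  rw [Complex.log_im]; rfl

end Phase

/-! ### Orbifolds -/

/-- A `C^∞` orbifold structure on the topological space `D`, given by an atlas of uniformizing
charts: connected (Hausdorff) manifolds `Chart i` modelled on `I`, finite groups `Grp i` acting
smoothly and effectively on them, and maps `proj i : Chart i → D` which induce homeomorphisms from
`Chart i / Grp i` onto open subsets covering `D`. Two charts are compatible in the usual sense:
points with the same image in `D` are related by a coordinate change, i.e. by a diffeomorphism
between open subsets of the charts that commutes with the maps to `D`. -/
structure OrbifoldAtlas {E : Type*} [NormedAddCommGroup E] [NormedSpace ℝ E]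
    {H : Type*} [TopologicalSpace H] (I : ModelWithCorners ℝ E H)
    (D : Type u) [TopologicalSpace D] where
  t2Space : T2Space D
  Idx : Type u
  Chart : Idx → Type u
  [topChart : ∀ i, TopologicalSpace (Chart i)]
  [t2Chart : ∀ i, T2Space (Chart i)]
  [connectedChart : ∀ i, ConnectedSpace (Chart i)]
  [chartedChart : ∀ i, ChartedSpace H (Chart i)]
  [manifoldChart : ∀ i, IsManifold I ∞ (Chart i)]
  Grp : Idx → Type u
  [groupGrp : ∀ i, Group (Grp i)]
  [finiteGrp : ∀ i, Finite (Grp i)]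
  [actGrp : ∀ i, MulAction (Grp i) (Chart i)]
  [faithfulGrp : ∀ i, FaithfulSMul (Grp i) (Chart i)]
  smooth_smul : ∀ i (γ : Grp i), ContMDiff I I ∞ (fun x : Chart i => γ • x)
  proj : ∀ i, Chart i → D
  continuous_proj : ∀ i, Continuous (proj i)
  isOpenMap_proj : ∀ i, IsOpenMap (proj i)
  proj_eq_iff : ∀ i (x y : Chart i), proj i x = proj i y ↔ ∃ γ : Grp i, γ • x = y
  cover : ∀ p : D, ∃ i, ∃ x : Chart i, proj i x = p
  compatible : ∀ i j (x : Chart i) (y : Chart j), proj i x = proj j y →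
    ∃ h : OpenPartialHomeomorph (Chart i) (Chart j), x ∈ h.source ∧ h x = y ∧
      ContMDiffOn I I ∞ h h.source ∧ ContMDiffOn I I ∞ h.symm h.target ∧
      ∀ x' ∈ h.source, proj j (h x') = proj i x'

namespace OrbifoldAtlas

attribute [instance] topChart t2Chart connectedChart chartedChart manifoldChart groupGrp finiteGrp
  actGrp faithfulGrp

variable {E : Type*} [NormedAddCommGroup E] [NormedSpace ℝ E]
  {H : Type*} [TopologicalSpace H] {I : ModelWithCorners ℝ E H}
  {D : Type u} [TopologicalSpace D]

/-- A coordinate change from the chart `i` to the chart `j`: a diffeomorphism between open subsets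
of the two charts that commutes with the projections to the orbifold. -/
structure Change (A : OrbifoldAtlas I D) (i j : A.Idx) where
  map : OpenPartialHomeomorph (A.Chart i) (A.Chart j)
  smooth : ContMDiffOn I I ∞ map map.source
  smooth_symm : ContMDiffOn I I ∞ map.symm map.target
  proj_map : ∀ x ∈ map.source, A.proj j (map x) = A.proj i x

variable {A : OrbifoldAtlas I D}

theorem exists_change {i j : A.Idx} {x : A.Chart i} {y : A.Chart j}
    (h : A.proj i x = A.proj j y) : ∃ t : A.Change i j, x ∈ t.map.source ∧ t.map x = y := by
  obtain ⟨f, h1, h2, h3, h4, h5⟩ := A.compatible i j x y h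
  exact ⟨⟨f, h3, h4, h5⟩, h1, h2⟩

namespace Change

def refl (A : OrbifoldAtlas I D) (i : A.Idx) : A.Change i i where
  map := OpenPartialHomeomorph.refl _
  smooth := contMDiffOn_id
  smooth_symm := contMDiffOn_id
  proj_map _ _ := rfl

def symm {i j : A.Idx} (t : A.Change i j) : A.Change j i where
  map := t.map.symm
  smooth := t.smooth_symm
  smooth_symm := t.smooth
  proj_map y hy := by
    rw [← t.proj_map _ (t.map.map_target hy), t.map.right_inv hy]

def trans {i j k : A.Idx} (s : A.Change i j) (t : A.Change j k) : A.Change i k where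
  map := s.map.trans t.map
  smooth := t.smooth.comp (s.smooth.mono fun _ hx => hx.1) fun _ hx => hx.2
  smooth_symm := s.smooth_symm.comp (t.smooth_symm.mono fun _ hx => hx.1) fun _ hx => hx.2
  proj_map _ hx := (t.proj_map _ hx.2).trans (s.proj_map _ hx.1)

/-- A group element, seen as a coordinate change from a chart to itself. -/
def ofGrp {i : A.Idx} (γ : A.Grp i) : A.Change i i where
  map := (Homeomorph.mk (MulAction.toPerm γ) (A.smooth_smul i γ).continuous
    (A.smooth_smul i γ⁻¹).continuous).toOpenPartialHomeomorph
  smooth := (A.smooth_smul i γ).contMDiffOn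
  smooth_symm := (A.smooth_smul i γ⁻¹).contMDiffOn
  proj_map _ _ := ((A.proj_eq_iff i _ _).2 ⟨γ, rfl⟩).symm

theorem rigid [I.Boundaryless] [CompleteSpace E] {i : A.Idx} (t : A.Change i i) {x : A.Chart i}
    (hx : x ∈ t.map.source) : ∃ γ : A.Grp i, t.map =ᶠ[𝓝 x] fun p => γ • p := by
  refine eventuallyEq_smul_of_mem_orbit (A.smooth_smul i) t.map.open_source t.smooth ?_ hx
  intro p hp
  obtain ⟨γ, hγ⟩ := (A.proj_eq_iff i _ _).1 (t.proj_map p hp).symm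
  exact ⟨γ, hγ.symm⟩

end Change

end OrbifoldAtlas

open OrbifoldAtlas

/-! ### Line orbibundles -/

/-- A `C^∞` complex orbifold line bundle over an orbifold, with local form `Chart i × ℂ` over an
atlas which trivializes it: every coordinate change `t` from chart `i` to chart `j` acts by
`(x, v) ↦ (t x, g t x * v)` with a smooth nowhere zero transition function `g t`, compatibly with
composition. Applied to group elements, this gives the action of the local group `Grp i` on
`Chart i × ℂ`. The value `g t x` depends on the germ of `t` at `x` only, as is seen by letting `s`
be the identity in `g_comp`. (Any finite family of orbifold line bundles has this form over a
suitable common atlas, for instance over every atlas with contractible charts.) -/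
structure LineOrbibundle {E : Type*} [NormedAddCommGroup E] [NormedSpace ℝ E]
    {H : Type*} [TopologicalSpace H] {I : ModelWithCorners ℝ E H}
    {D : Type u} [TopologicalSpace D] (A : OrbifoldAtlas I D) where
  g : ∀ {i j : A.Idx}, A.Change i j → A.Chart i → ℂ
  g_ne_zero : ∀ {i j : A.Idx} (t : A.Change i j), ∀ x ∈ t.map.source, g t x ≠ 0
  smooth_g : ∀ {i j : A.Idx} (t : A.Change i j), ContMDiffOn I 𝓘(ℝ, ℂ) ∞ (g t) t.map.source
  g_comp : ∀ {i j k : A.Idx} (s : A.Change i j) (t : A.Change j k) (r : A.Change i k)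
    (x : A.Chart i), x ∈ s.map.source → s.map x ∈ t.map.source → x ∈ r.map.source →
    r.map =ᶠ[𝓝 x] t.map ∘ s.map → g r x = g t (s.map x) * g s x

namespace LineOrbibundle

variable {E : Type*} [NormedAddCommGroup E] [NormedSpace ℝ E]
  {H : Type*} [TopologicalSpace H] {I : ModelWithCorners ℝ E H}
  {D : Type u} [TopologicalSpace D] {A : OrbifoldAtlas I D}

/-- Two line orbibundles are isomorphic if there are smooth nowhere zero functions `e i` on the
charts such that the bundle maps `(x, v) ↦ (x, e i x * v)` commute with all coordinate changes. -/
def Isomorphic (P Q : LineOrbibundle A) : Prop :=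
  ∃ e : ∀ i : A.Idx, A.Chart i → ℂ,
    (∀ i, ContMDiff I 𝓘(ℝ, ℂ) ∞ (e i)) ∧ (∀ i x, e i x ≠ 0) ∧
    ∀ (i j : A.Idx) (t : A.Change i j), ∀ x ∈ t.map.source,
      e j (t.map x) * P.g t x = Q.g t x * e i x

/-- The trivial line orbibundle. -/
def trivial (A : OrbifoldAtlas I D) : LineOrbibundle A where
  g _ _ := 1
  g_ne_zero _ _ _ := one_ne_zero
  smooth_g _ := contMDiffOn_const
  g_comp _ _ _ _ _ _ _ _ := (one_mul _).symm

/-- A line orbibundle is trivial if it is isomorphic to the trivial line orbibundle. -/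
def IsTrivial (P : LineOrbibundle A) : Prop := P.Isomorphic (trivial A)

/-- The tensor power `N ^ k` of a line orbibundle, for an integer `k`: its transition functions are
the `k`-th powers of those of `N` (so negative powers are powers of the dual). -/
instance : Pow (LineOrbibundle A) ℤ where
  pow N k :=
    { g := fun t x => N.g t x ^ k
      g_ne_zero := fun t x hx => zpow_ne_zero _ (N.g_ne_zero t x hx)
      smooth_g := fun t x hx => by
        have h1 : ContDiffAt ℝ ∞ (fun w : ℂ => w ^ k) (N.g t x) := by
          have h0 := N.g_ne_zero t x hx
          rcases k with k | k
          · simpa using (contDiff_id.pow k).contDiffAt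
          · simp only [zpow_negSucc]
            exact ((contDiff_id.pow (k + 1)).contDiffAt).inv (pow_ne_zero _ h0)
        exact h1.contMDiffAt.comp_contMDiffWithinAt x (N.smooth_g t x hx)
      g_comp := fun s t r x hs ht hr h => by
        rw [N.g_comp s t r x hs ht hr h, mul_zpow] }

theorem g_congr (N : LineOrbibundle A) {i j : A.Idx} (s t : A.Change i j) {x : A.Chart i}
    (hs : x ∈ s.map.source) (ht : x ∈ t.map.source) (h : s.map =ᶠ[𝓝 x] t.map) :
    N.g s x = N.g t x := by
  have h1 := N.g_comp (Change.refl A i) (Change.refl A i) (Change.refl A i) x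
    (mem_univ _) (mem_univ _) (mem_univ _) EventuallyEq.rfl
  have h2 : N.g (Change.refl A i) x ≠ 0 := N.g_ne_zero _ x (mem_univ _)
  have h3 : N.g (Change.refl A i) x = 1 := (mul_eq_left₀ h2).1 h1.symm
  have h4 := N.g_comp (Change.refl A i) t s x (mem_univ _) ht hs h
  rw [h3, mul_one] at h4
  exact h4

theorem g_refl (N : LineOrbibundle A) (i : A.Idx) (x : A.Chart i) :
    N.g (Change.refl A i) x = 1 := by
  have h1 := N.g_comp (Change.refl A i) (Change.refl A i) (Change.refl A i) x
    (mem_univ _) (mem_univ _) (mem_univ _) EventuallyEq.rfl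
  have h2 : N.g (Change.refl A i) x ≠ 0 := N.g_ne_zero _ x (mem_univ _)
  exact (mul_eq_left₀ h2).1 h1.symm

theorem g_trans (N : LineOrbibundle A) {i j k : A.Idx} (s : A.Change i j) (t : A.Change j k)
    {x : A.Chart i} (hs : x ∈ s.map.source) (ht : s.map x ∈ t.map.source) :
    N.g (s.trans t) x = N.g t (s.map x) * N.g s x :=
  N.g_comp s t (s.trans t) x hs ht ⟨hs, ht⟩ EventuallyEq.rfl

theorem g_symm_mul (N : LineOrbibundle A) {i j : A.Idx} (t : A.Change i j) {x : A.Chart i}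
    (hx : x ∈ t.map.source) : N.g t.symm (t.map x) * N.g t x = 1 := by
  rw [← N.g_comp t t.symm (Change.refl A i) x hx (t.map.map_source hx) (mem_univ _), N.g_refl]
  filter_upwards [t.map.open_source.mem_nhds hx] with p hp
  exact (t.map.left_inv hp).symm

theorem continuousOn_g (N : LineOrbibundle A) {i j : A.Idx} (t : A.Change i j) :
    ContinuousOn (N.g t) t.map.source := (N.smooth_g t).continuousOn

/-! ### The total space, Hermitian metrics and the unit circle bundle -/

/-- The vector `v` over the point `x` of the chart `i` and the vector `w` over the point `y` of the
chart `j` are related if some coordinate change of the orbifold carries `(x, v)` to `(y, w)`. -/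
def TotalRel (N : LineOrbibundle A) {i j : A.Idx} (x : A.Chart i) (v : ℂ) (y : A.Chart j)
    (w : ℂ) : Prop :=
  ∃ t : A.Change i j, x ∈ t.map.source ∧ t.map x = y ∧ N.g t x * v = w

theorem TotalRel.symm {N : LineOrbibundle A} {i j : A.Idx} {x : A.Chart i} {v : ℂ} {y : A.Chart j}
    {w : ℂ} (h : N.TotalRel x v y w) : N.TotalRel y w x v := by
  obtain ⟨t, hx, rfl, rfl⟩ := h
  refine ⟨t.symm, t.map.map_source hx, t.map.left_inv hx, ?_⟩
  rw [← mul_assoc, N.g_symm_mul t hx, one_mul]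

theorem TotalRel.trans {N : LineOrbibundle A} {i j k : A.Idx} {x : A.Chart i} {v : ℂ}
    {y : A.Chart j} {w : ℂ} {z : A.Chart k} {u : ℂ} (h : N.TotalRel x v y w)
    (h' : N.TotalRel y w z u) : N.TotalRel x v z u := by
  obtain ⟨s, hx, rfl, rfl⟩ := h
  obtain ⟨t, hy, rfl, rfl⟩ := h'
  exact ⟨s.trans t, ⟨hx, hy⟩, rfl, by rw [N.g_trans s t hx hy, mul_assoc]⟩

/-- The equivalence relation on the disjoint union of the `Chart i × ℂ` given by the action of
the coordinate changes on the line orbibundle `N`. -/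
def totalSetoid (N : LineOrbibundle A) : Setoid (Σ i : A.Idx, A.Chart i × ℂ) where
  r p q := N.TotalRel p.2.1 p.2.2 q.2.1 q.2.2
  iseqv :=
    { refl := fun p => ⟨Change.refl A p.1, mem_univ _, rfl, by rw [N.g_refl, one_mul]⟩
      symm := TotalRel.symm
      trans := TotalRel.trans }

/-- The total space of a line orbibundle, glued from the local pieces `(Chart i × ℂ) / Grp i`, with
the quotient topology. -/
def TotalSpace (N : LineOrbibundle A) : Type u := Quotient N.totalSetoid

instance (N : LineOrbibundle A) : TopologicalSpace N.TotalSpace :=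
  inferInstanceAs (TopologicalSpace (Quotient N.totalSetoid))

/-- The point of the total space with local coordinates `(x, v)` over the chart `i`. -/
def TotalSpace.mk {N : LineOrbibundle A} (i : A.Idx) (x : A.Chart i) (v : ℂ) : N.TotalSpace :=
  Quotient.mk N.totalSetoid ⟨i, x, v⟩

theorem TotalSpace.mk_eq_mk {N : LineOrbibundle A} {i j : A.Idx} {x : A.Chart i} {y : A.Chart j}
    {v w : ℂ} : (TotalSpace.mk i x v : N.TotalSpace) = TotalSpace.mk j y w ↔
      N.TotalRel x v y w :=
  Quotient.eq (r := N.totalSetoid)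

theorem TotalSpace.exists_mk {N : LineOrbibundle A} (p : N.TotalSpace) :
    ∃ i x v, p = TotalSpace.mk i x v := by
  obtain ⟨⟨i, x, v⟩, rfl⟩ := Quotient.exists_rep (s := N.totalSetoid) p
  exact ⟨i, x, v, rfl⟩

/-- The projection `p : N → D`. -/
def TotalSpace.toBase {N : LineOrbibundle A} : N.TotalSpace → D :=
  Quotient.lift (fun p => A.proj p.1 p.2.1) (by
    rintro ⟨i, x, v⟩ ⟨j, y, w⟩ (h : N.TotalRel x v y w)
    obtain ⟨t, hx, rfl, rfl⟩ := h
    exact (t.proj_map x hx).symm)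

theorem TotalSpace.continuous_toBase {N : LineOrbibundle A} :
    Continuous (TotalSpace.toBase : N.TotalSpace → D) :=
  Continuous.quotient_lift (continuous_sigma fun i => (A.continuous_proj i).comp continuous_fst) _

theorem TotalSpace.continuous_mk {N : LineOrbibundle A} (i : A.Idx) :
    Continuous (fun p : A.Chart i × ℂ => (TotalSpace.mk i p.1 p.2 : N.TotalSpace)) :=
  continuous_quotient_mk'.comp (continuous_sigmaMk (σ := fun i => A.Chart i × ℂ) (i := i))

theorem TotalSpace.isOpenMap_mk {N : LineOrbibundle A} (i : A.Idx) :
    IsOpenMap (fun p : A.Chart i × ℂ => (TotalSpace.mk i p.1 p.2 : N.TotalSpace)) := by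
  intro O hO
  refine isOpen_coinduced.2 (isOpen_sigma_iff.2 fun j => ?_)
  have key : {q : A.Chart j × ℂ | ∃ p ∈ O, (TotalSpace.mk i p.1 p.2 : N.TotalSpace) =
      TotalSpace.mk j q.1 q.2} = ⋃ t : A.Change j i, (t.map.source ×ˢ univ) ∩
        (fun q : A.Chart j × ℂ => (t.map q.1, N.g t q.1 * q.2)) ⁻¹' O := by
    ext ⟨y, w⟩
    simp only [mem_preimage, mem_ofPred_eq, mem_iUnion, mem_inter_iff, mem_prod, mem_univ, and_true]
    constructor
    · rintro ⟨⟨x, v⟩, hp, h⟩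
      obtain ⟨t, h1, h2, h3⟩ := TotalSpace.mk_eq_mk.1 h.symm
      exact ⟨t, h1, by rw [h2, h3]; exact hp⟩
    · rintro ⟨t, h1, h2⟩
      exact ⟨_, h2, (TotalSpace.mk_eq_mk.2 ⟨t, h1, rfl, rfl⟩).symm⟩
  change IsOpen {q : A.Chart j × ℂ | ∃ p ∈ O, (TotalSpace.mk i p.1 p.2 : N.TotalSpace) =
      TotalSpace.mk j q.1 q.2}
  rw [key]
  refine isOpen_iUnion fun t => ContinuousOn.isOpen_inter_preimage ?_
    (t.map.open_source.prod isOpen_univ) hO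
  refine ContinuousOn.prodMk (t.map.continuousOn.comp continuousOn_fst fun q hq => hq.1) ?_
  exact ((N.continuousOn_g t).comp continuousOn_fst fun q hq => hq.1).mul continuousOn_snd

/-- A smooth Hermitian metric on a line orbibundle: the squared length of the vector `v` over the
point `x` of the chart `i` is `weight i x * |v|²`. -/
structure HermitianMetric (N : LineOrbibundle A) where
  weight : ∀ i : A.Idx, A.Chart i → ℝ
  weight_pos : ∀ i x, 0 < weight i x
  smooth_weight : ∀ i, ContMDiff I 𝓘(ℝ, ℝ) ∞ (weight i)
  weight_map : ∀ {i j : A.Idx} (t : A.Change i j), ∀ x ∈ t.map.source,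
    weight j (t.map x) * ‖N.g t x‖ ^ 2 = weight i x

/-- The squared length of a point of the total space. -/
def HermitianMetric.normSq {N : LineOrbibundle A} (h : N.HermitianMetric) : N.TotalSpace → ℝ :=
  Quotient.lift (fun p => h.weight p.1 p.2.1 * ‖p.2.2‖ ^ 2) (by
    rintro ⟨i, x, v⟩ ⟨j, y, w⟩ (hr : N.TotalRel x v y w)
    obtain ⟨t, hx, rfl, rfl⟩ := hr
    dsimp only
    rw [norm_mul, mul_pow, ← mul_assoc, h.weight_map t x hx])

/-- The unit circle bundle `L` of a line orbibundle `N` with respect to a Hermitian metric, as a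
subspace of the total space of `N`. -/
def UnitCircleBundle (N : LineOrbibundle A) (h : N.HermitianMetric) : Type u :=
  {p : N.TotalSpace // h.normSq p = 1}

variable {N : LineOrbibundle A}

instance (h : N.HermitianMetric) : TopologicalSpace (N.UnitCircleBundle h) :=
  inferInstanceAs (TopologicalSpace {p : N.TotalSpace // h.normSq p = 1})

/-- The action of a coordinate change of the base on the local pieces `Chart i × S¹` of the unit
circle bundle: `(x, z) ↦ (t x, (g t x / |g t x|) * z)`. -/
def circleLift (N : LineOrbibundle A) {i j : A.Idx} (t : A.Change i j) :
    OpenPartialHomeomorph (A.Chart i × Circle) (A.Chart j × Circle) where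
  toFun p := (t.map p.1, phase (N.g t p.1) * p.2)
  invFun q := (t.map.symm q.1, (phase (N.g t (t.map.symm q.1)))⁻¹ * q.2)
  source := t.map.source ×ˢ univ
  target := t.map.target ×ˢ univ
  map_source' p hp := ⟨t.map.map_source hp.1, mem_univ _⟩
  map_target' q hq := ⟨t.map.map_target hq.1, mem_univ _⟩
  left_inv' p hp := by
    ext1
    · exact t.map.left_inv hp.1
    · dsimp only
      rw [t.map.left_inv hp.1, inv_mul_cancel_left]
  right_inv' q hq := by
    ext1
    · exact t.map.right_inv hq.1
    · dsimp only
      rw [mul_inv_cancel_left]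
  open_source := t.map.open_source.prod isOpen_univ
  open_target := t.map.open_target.prod isOpen_univ
  continuousOn_toFun := by
    refine ContinuousOn.prodMk (t.map.continuousOn.comp continuousOn_fst fun p hp => hp.1) ?_
    refine ContinuousOn.mul ?_ continuousOn_snd
    intro p hp
    have h1 : ContinuousAt phase (N.g t p.1) := (contMDiffAt_phase (N.g_ne_zero t _ hp.1)).continuousAt
    exact ContinuousAt.comp_continuousWithinAt (f := fun p : A.Chart i × Circle => N.g t p.1) h1
      (((N.continuousOn_g t).comp continuousOn_fst fun p hp => hp.1) p hp)
  continuousOn_invFun := by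
    have hs : ContinuousOn (fun q : A.Chart j × Circle => t.map.symm q.1)
        (t.map.target ×ˢ univ) := t.map.symm.continuousOn.comp continuousOn_fst fun p hp => hp.1
    refine ContinuousOn.prodMk hs ?_
    refine ContinuousOn.mul (ContinuousOn.inv ?_) continuousOn_snd
    intro q hq
    have h1 : ContinuousAt phase (N.g t (t.map.symm q.1)) :=
      (contMDiffAt_phase (N.g_ne_zero t _ (t.map.map_target hq.1))).continuousAt
    exact ContinuousAt.comp_continuousWithinAt
      (f := fun q : A.Chart j × Circle => N.g t (t.map.symm q.1)) h1
      (((N.continuousOn_g t).comp hs fun p hp => t.map.map_target hp.1) q hq)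

theorem circleLift_apply (N : LineOrbibundle A) {i j : A.Idx} (t : A.Change i j)
    (p : A.Chart i × Circle) :
    N.circleLift t p = (t.map p.1, phase (N.g t p.1) * p.2) := rfl

theorem contMDiffOn_circleLift (N : LineOrbibundle A) {i j : A.Idx} (t : A.Change i j) :
    ContMDiffOn (I.prod (𝓡 1)) (I.prod (𝓡 1)) ∞ (N.circleLift t) (N.circleLift t).source := by
  refine ContMDiffOn.prodMk (t.smooth.comp contMDiffOn_fst fun p hp => hp.1) ?_
  refine ContMDiffOn.mul ?_ contMDiffOn_snd
  intro p hp
  exact ContMDiffAt.comp_contMDiffWithinAt (f := fun p : A.Chart i × Circle => N.g t p.1) p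
    (contMDiffAt_phase (N.g_ne_zero t _ hp.1))
    (((N.smooth_g t).comp contMDiffOn_fst fun p hp => hp.1) p hp)

theorem contMDiffOn_circleLift_symm (N : LineOrbibundle A) {i j : A.Idx} (t : A.Change i j) :
    ContMDiffOn (I.prod (𝓡 1)) (I.prod (𝓡 1)) ∞ (N.circleLift t).symm
      (N.circleLift t).target := by
  have hs : ContMDiffOn (I.prod (𝓡 1)) I ∞ (fun q : A.Chart j × Circle => t.map.symm q.1)
      (t.map.target ×ˢ univ) := t.smooth_symm.comp contMDiffOn_fst fun p hp => hp.1
  refine ContMDiffOn.prodMk hs ?_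
  refine ContMDiffOn.mul (ContMDiffOn.inv ?_) contMDiffOn_snd
  intro q hq
  exact ContMDiffAt.comp_contMDiffWithinAt
    (f := fun q : A.Chart j × Circle => N.g t (t.map.symm q.1)) q
    (contMDiffAt_phase (N.g_ne_zero t _ (t.map.map_target hq.1)))
    (((N.smooth_g t).comp hs fun p hp => t.map.map_target hp.1) q hq)

theorem contMDiff_circleLift_ofGrp (N : LineOrbibundle A) {i : A.Idx} (γ : A.Grp i) :
    ContMDiff (I.prod (𝓡 1)) (I.prod (𝓡 1)) ∞ (N.circleLift (Change.ofGrp γ)) := by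
  have h1 := N.contMDiffOn_circleLift (Change.ofGrp γ)
  have h2 : (N.circleLift (Change.ofGrp γ)).source = univ := univ_prod_univ
  rwa [h2, contMDiffOn_univ] at h1

theorem eventuallyEq_of_circleLift {N : LineOrbibundle A} {i j : A.Idx} {s t : A.Change i j}
    {p : A.Chart i × Circle}
    (hst : (N.circleLift s : A.Chart i × Circle → A.Chart j × Circle) =ᶠ[𝓝 p] N.circleLift t) :
    s.map =ᶠ[𝓝 p.1] t.map := by
  have h2 : Tendsto (fun x : A.Chart i => (x, p.2)) (𝓝 p.1) (𝓝 p) :=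
    (Continuous.prodMk_left p.2).tendsto p.1
  filter_upwards [h2.eventually hst] with x hx
  exact congrArg Prod.fst hx

namespace UnitCircleBundle

variable {h : N.HermitianMetric}

/-- The point of the unit circle bundle with local coordinates `(x, z)` over the chart `i`, that is,
the unit vector `z / |1|` over `x`, where `|1|` is the length of the local frame at `x`. -/
def mk (h : N.HermitianMetric) (i : A.Idx) (x : A.Chart i) (z : Circle) : N.UnitCircleBundle h :=
  ⟨TotalSpace.mk i x ((z : ℂ) / (√(h.weight i x) : ℝ)), by
    change h.weight i x * ‖(z : ℂ) / (√(h.weight i x) : ℝ)‖ ^ 2 = 1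
    have hp := h.weight_pos i x
    rw [norm_div, Circle.norm_coe, Complex.norm_real, Real.norm_of_nonneg (Real.sqrt_nonneg _),
      div_pow, Real.sq_sqrt hp.le, one_pow, mul_one_div_cancel hp.ne']⟩

/-- The projection `p|_L : L → D`. -/
def toBase (p : N.UnitCircleBundle h) : D := TotalSpace.toBase p.1

theorem continuous_toBase : Continuous (toBase : N.UnitCircleBundle h → D) :=
  TotalSpace.continuous_toBase.comp continuous_subtype_val

theorem toBase_mk (i : A.Idx) (x : A.Chart i) (z : Circle) : toBase (mk h i x z) = A.proj i x := rfl

theorem mk_eq_mk {i j : A.Idx} {x : A.Chart i} {y : A.Chart j} {z w : Circle} :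
    mk h i x z = mk h j y w ↔
      ∃ t : A.Change i j, x ∈ t.map.source ∧ t.map x = y ∧ phase (N.g t x) * z = w := by
  refine Subtype.ext_iff.trans (TotalSpace.mk_eq_mk.trans ?_)
  refine exists_congr fun t => and_congr_right fun hx => and_congr_right fun hy => ?_
  subst hy
  have h1 : √(h.weight i x) = √(h.weight j (t.map x)) * ‖N.g t x‖ := by
    rw [← h.weight_map t x hx, Real.sqrt_mul (h.weight_pos _ _).le,
      Real.sqrt_sq (norm_nonneg _)]
  have h2 : (√(h.weight j (t.map x)) : ℂ) ≠ 0 := by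
    exact_mod_cast (Real.sqrt_pos.2 (h.weight_pos _ _)).ne'
  have h3 : (‖N.g t x‖ : ℂ) ≠ 0 := by
    exact_mod_cast (norm_pos_iff.2 (N.g_ne_zero t x hx)).ne'
  have h4 : N.g t x * ((z : ℂ) / (√(h.weight i x) : ℝ)) =
      ((phase (N.g t x) * z : Circle) : ℂ) / (√(h.weight j (t.map x)) : ℝ) := by
    rw [h1, Circle.coe_mul]
    nth_rewrite 1 [← norm_mul_phase (N.g t x)]
    push_cast
    field_simp
  rw [h4, div_left_inj' h2, Circle.coe_inj]

theorem exists_mk (p : N.UnitCircleBundle h) : ∃ i x z, p = mk h i x z := by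
  obtain ⟨p, hp⟩ := p
  obtain ⟨i, x, v, rfl⟩ := TotalSpace.exists_mk p
  refine ⟨i, x, phase v, ?_⟩
  apply Subtype.ext
  change TotalSpace.mk i x v = TotalSpace.mk i x ((phase v : ℂ) / (√(h.weight i x) : ℝ))
  congr 1
  have h1 : h.weight i x * ‖v‖ ^ 2 = 1 := hp
  have hs := Real.sqrt_pos.2 (h.weight_pos i x)
  have h2 : √(h.weight i x) * ‖v‖ = 1 := by
    rw [← Real.sqrt_one, ← h1, Real.sqrt_mul (h.weight_pos _ _).le, Real.sqrt_sq (norm_nonneg _)]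
  have h3 : (√(h.weight i x) : ℂ) ≠ 0 := by exact_mod_cast hs.ne'
  have h4 : (√(h.weight i x) : ℂ) * ‖v‖ = 1 := by exact_mod_cast h2
  rw [eq_div_iff h3]
  nth_rewrite 1 [← norm_mul_phase v]
  linear_combination (phase v : ℂ) * h4

theorem continuous_mk (i : A.Idx) :
    Continuous (fun p : A.Chart i × Circle => mk h i p.1 p.2) := by
  refine Continuous.subtype_mk ((TotalSpace.continuous_mk i).comp
    (continuous_fst.prodMk (Continuous.div (continuous_subtype_val.comp continuous_snd) ?_ ?_))) _
  · exact Complex.continuous_ofReal.comp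
      (Real.continuous_sqrt.comp ((h.smooth_weight i).continuous.comp continuous_fst))
  · intro p
    exact_mod_cast (Real.sqrt_pos.2 (h.weight_pos _ _)).ne'

theorem isOpenMap_mk (i : A.Idx) : IsOpenMap (fun p : A.Chart i × Circle => mk h i p.1 p.2) := by
  intro O hO
  have ho : IsOpen ({p : A.Chart i × ℂ | p.2 ≠ 0} ∩
      (fun p : A.Chart i × ℂ => (p.1, phase p.2)) ⁻¹' O) := by
    refine ContinuousOn.isOpen_inter_preimage ?_ (isOpen_ne.preimage continuous_snd) hO
    refine continuousOn_fst.prodMk ?_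
    intro p hp
    have h1 : ContinuousAt phase p.2 := (contMDiffAt_phase hp).continuousAt
    exact h1.comp_continuousWithinAt continuousWithinAt_snd
  have h2 := (TotalSpace.isOpenMap_mk (N := N) i _ ho).preimage
    (continuous_subtype_val (p := fun p : N.TotalSpace => h.normSq p = 1))
  refine (?_ : (fun p : A.Chart i × Circle => mk h i p.1 p.2) '' O = _) ▸ h2
  ext q
  constructor
  · rintro ⟨⟨x, z⟩, hp, rfl⟩
    have hs := Real.sqrt_pos.2 (h.weight_pos i x)
    refine ⟨(x, (z : ℂ) / (√(h.weight i x) : ℝ)), ⟨?_, ?_⟩, rfl⟩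
    · exact div_ne_zero (Circle.coe_ne_zero z) (by exact_mod_cast hs.ne')
    · have : phase ((z : ℂ) / (√(h.weight i x) : ℝ)) = z := by
        apply phase_eq_of_norm_mul (inv_pos.2 hs)
        push_cast
        rw [div_eq_inv_mul]
      simpa [this] using hp
  · rintro ⟨⟨x, v⟩, ⟨hv, hp⟩, hq⟩
    refine ⟨(x, phase v), hp, ?_⟩
    apply Subtype.ext
    rw [← hq]
    have h1 : h.weight i x * ‖v‖ ^ 2 = 1 := by
      have := q.2
      rw [← hq] at this
      exact this
    have hs := Real.sqrt_pos.2 (h.weight_pos i x)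
    have h2 : √(h.weight i x) * ‖v‖ = 1 := by
      rw [← Real.sqrt_one, ← h1, Real.sqrt_mul (h.weight_pos _ _).le, Real.sqrt_sq (norm_nonneg _)]
    change TotalSpace.mk i x ((phase v : ℂ) / (√(h.weight i x) : ℝ)) = TotalSpace.mk i x v
    congr 1
    have h3 : (√(h.weight i x) : ℂ) ≠ 0 := by exact_mod_cast hs.ne'
    have h4 : (√(h.weight i x) : ℂ) * ‖v‖ = 1 := by exact_mod_cast h2
    rw [div_eq_iff h3]
    nth_rewrite 2 [← norm_mul_phase v]
    linear_combination -(phase v : ℂ) * h4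

/-- The action of the local group `Grp i` on `Chart i × S¹`. -/
@[reducible] def mulAction (N : LineOrbibundle A) (i : A.Idx) : MulAction (A.Grp i) (A.Chart i × Circle) where
  smul γ p := N.circleLift (Change.ofGrp γ) p
  one_smul p := by
    change N.circleLift (Change.ofGrp 1) p = p
    rw [circleLift_apply, N.g_congr (Change.ofGrp 1) (Change.refl A i) (mem_univ _) (mem_univ _)
      (Eventually.of_forall fun x => one_smul _ x), N.g_refl, phase_one, one_mul]
    exact Prod.ext (one_smul _ _) rfl
  mul_smul γ δ p := by
    change N.circleLift (Change.ofGrp (γ * δ)) p =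
      N.circleLift (Change.ofGrp γ) (N.circleLift (Change.ofGrp δ) p)
    simp only [circleLift_apply]
    rw [N.g_comp (Change.ofGrp δ) (Change.ofGrp γ) (Change.ofGrp (γ * δ)) p.1 (mem_univ _)
      (mem_univ _) (mem_univ _) (Eventually.of_forall fun x => mul_smul _ _ x),
      phase_mul (N.g_ne_zero _ _ (mem_univ _)) (N.g_ne_zero _ _ (mem_univ _)), mul_assoc]
    exact Prod.ext (mul_smul _ _ _) rfl

theorem mk_eq_mk_iff_exists_smul [I.Boundaryless] [CompleteSpace E] (i : A.Idx)
    (p q : A.Chart i × Circle) :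
    mk h i p.1 p.2 = mk h i q.1 q.2 ↔ ∃ γ : A.Grp i, N.circleLift (Change.ofGrp γ) p = q := by
  rw [mk_eq_mk]
  constructor
  · rintro ⟨t, hx, h1, h2⟩
    obtain ⟨γ, hγ⟩ := t.rigid hx
    refine ⟨γ, Prod.ext (hγ.self_of_nhds.symm.trans h1) ?_⟩
    rw [← h2, N.g_congr t (Change.ofGrp γ) hx (mem_univ _) hγ]
    rfl
  · rintro ⟨γ, rfl⟩
    exact ⟨Change.ofGrp γ, mem_univ _, rfl, rfl⟩

theorem t2Space [I.Boundaryless] [CompleteSpace E] : T2Space (N.UnitCircleBundle h) := by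
  have := A.t2Space
  refine ⟨fun p q hpq => ?_⟩
  by_cases hb : toBase p = toBase q
  · obtain ⟨i, x, z, rfl⟩ := exists_mk p
    obtain ⟨j, y, w, rfl⟩ := exists_mk q
    obtain ⟨t, ht, rfl⟩ := exists_change (A := A) (i := j) (j := i) (x := y) (y := x) hb.symm
    have hq : mk h j y w = mk h i (t.map y) (phase (N.g t y) * w) := mk_eq_mk.2 ⟨t, ht, rfl, rfl⟩
    rw [hq] at hpq ⊢
    set P : A.Chart i × Circle := (t.map y, z) with hP
    set Q : A.Chart i × Circle := (t.map y, phase (N.g t y) * w) with hQ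
    have hne : ∀ γ : A.Grp i, N.circleLift (Change.ofGrp γ) P ≠ Q := fun γ hγ =>
      hpq ((mk_eq_mk_iff_exists_smul i P Q).2 ⟨γ, hγ⟩)
    choose U V hU hV hPU hQV hUV using fun γ => t2_separation (hne γ)
    have hc : ∀ γ : A.Grp i, Continuous (N.circleLift (Change.ofGrp γ)) := fun γ => by
      have h1 := (N.circleLift (Change.ofGrp γ)).continuousOn
      have h2 : (N.circleLift (Change.ofGrp γ)).source = univ := univ_prod_univ
      rwa [h2, continuousOn_univ] at h1
    refine ⟨(fun p : A.Chart i × Circle => mk h i p.1 p.2) ''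
        (⋂ γ, N.circleLift (Change.ofGrp γ) ⁻¹' U γ),
      (fun p : A.Chart i × Circle => mk h i p.1 p.2) '' (⋂ γ, V γ),
      isOpenMap_mk i _ (isOpen_iInter_of_finite fun γ => (hU γ).preimage (hc γ)),
      isOpenMap_mk i _ (isOpen_iInter_of_finite hV),
      ⟨P, mem_iInter.2 hPU, rfl⟩, ⟨Q, mem_iInter.2 hQV, rfl⟩, ?_⟩
    rw [Set.disjoint_left]
    rintro _ ⟨a, ha, rfl⟩ ⟨b, hb, hab⟩
    obtain ⟨γ, rfl⟩ := (mk_eq_mk_iff_exists_smul i a b).1 hab.symm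
    exact Set.disjoint_left.1 (hUV γ) (mem_iInter.1 ha γ) (mem_iInter.1 hb γ)
  · obtain ⟨U, V, hU, hV, hpU, hqV, hUV⟩ := t2_separation hb
    exact ⟨_, _, hU.preimage continuous_toBase, hV.preimage continuous_toBase, hpU, hqV,
      hUV.preimage _⟩

end UnitCircleBundle

/-- The orbifold structure of the unit circle bundle `L`: its uniformizing charts are the maps
`Chart i × S¹ → L`, with the group `Grp i` acting on both factors. -/
def unitCircleAtlas [I.Boundaryless] [CompleteSpace E] (N : LineOrbibundle A)
    (h : N.HermitianMetric) :
    OrbifoldAtlas (I.prod (𝓡 1)) (N.UnitCircleBundle h) where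
  t2Space := UnitCircleBundle.t2Space
  Idx := A.Idx
  Chart i := A.Chart i × Circle
  Grp := A.Grp
  actGrp := UnitCircleBundle.mulAction N
  faithfulGrp i := by
    let _ := UnitCircleBundle.mulAction N i
    refine ⟨fun {γ δ} hγδ => FaithfulSMul.eq_of_smul_eq_smul (α := A.Chart i) fun x => ?_⟩
    exact congrArg Prod.fst (hγδ (x, 1))
  smooth_smul _ γ := N.contMDiff_circleLift_ofGrp γ
  proj i p := UnitCircleBundle.mk h i p.1 p.2
  continuous_proj := UnitCircleBundle.continuous_mk
  isOpenMap_proj := UnitCircleBundle.isOpenMap_mk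
  proj_eq_iff := UnitCircleBundle.mk_eq_mk_iff_exists_smul
  cover p := by
    obtain ⟨i, x, z, rfl⟩ := UnitCircleBundle.exists_mk p
    exact ⟨i, (x, z), rfl⟩
  compatible i j p q hpq := by
    obtain ⟨t, hx, h1, h2⟩ := UnitCircleBundle.mk_eq_mk.1 hpq
    exact ⟨N.circleLift t, ⟨hx, mem_univ _⟩, Prod.ext h1 h2, N.contMDiffOn_circleLift t,
      N.contMDiffOn_circleLift_symm t, fun p' hp' =>
      (UnitCircleBundle.mk_eq_mk.2 ⟨t, hp'.1, rfl, rfl⟩).symm⟩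

/-! ### Pullback to the unit circle bundle -/

section Pullback

open scoped Classical in
/-- The transition functions of the pullback of `Q`: if the coordinate change `T` of the unit circle
bundle is induced near `p = (x, z)` by the coordinate change `t` of the base, then its value at `p`
is the value of the transition function of `Q` for `t` at `x`. -/
def pullbackG (N Q : LineOrbibundle A) {i j : A.Idx}
    (T : OpenPartialHomeomorph (A.Chart i × Circle) (A.Chart j × Circle))
    (p : A.Chart i × Circle) : ℂ :=
  if hT : ∃ t : A.Change i j, p.1 ∈ t.map.source ∧ T =ᶠ[𝓝 p] N.circleLift t then
    Q.g hT.choose p.1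
  else 1

theorem pullbackG_eq (N Q : LineOrbibundle A) {i j : A.Idx}
    {T : OpenPartialHomeomorph (A.Chart i × Circle) (A.Chart j × Circle)}
    {p : A.Chart i × Circle} (t : A.Change i j) (ht : p.1 ∈ t.map.source)
    (hT : T =ᶠ[𝓝 p] N.circleLift t) : pullbackG N Q T p = Q.g t p.1 := by
  have hex : ∃ t : A.Change i j, p.1 ∈ t.map.source ∧ T =ᶠ[𝓝 p] N.circleLift t := ⟨t, ht, hT⟩
  rw [pullbackG, dif_pos hex]
  exact Q.g_congr _ _ hex.choose_spec.1 ht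
    (eventuallyEq_of_circleLift (hex.choose_spec.2.symm.trans hT))

theorem pullbackG_comp (N Q : LineOrbibundle A) {i j k : A.Idx}
    {S : OpenPartialHomeomorph (A.Chart i × Circle) (A.Chart j × Circle)}
    {T : OpenPartialHomeomorph (A.Chart j × Circle) (A.Chart k × Circle)}
    {R : OpenPartialHomeomorph (A.Chart i × Circle) (A.Chart k × Circle)}
    {p : A.Chart i × Circle} (hS : p ∈ S.source) (hcomp : R =ᶠ[𝓝 p] T ∘ S)
    (exS : ∃ t : A.Change i j, p.1 ∈ t.map.source ∧ S =ᶠ[𝓝 p] N.circleLift t)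
    (exT : ∃ t : A.Change j k, (S p).1 ∈ t.map.source ∧ T =ᶠ[𝓝 (S p)] N.circleLift t)
    (exR : ∃ t : A.Change i k, p.1 ∈ t.map.source ∧ R =ᶠ[𝓝 p] N.circleLift t) :
    pullbackG N Q R p = pullbackG N Q T (S p) * pullbackG N Q S p := by
  obtain ⟨s, hs, hsS⟩ := exS
  obtain ⟨t, ht, htT⟩ := exT
  obtain ⟨r, hr, hrR⟩ := exR
  have h1 : (S p).1 = s.map p.1 := congrArg Prod.fst hsS.self_of_nhds
  have ht' : s.map p.1 ∈ t.map.source := h1 ▸ ht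
  rw [pullbackG_eq N Q r hr hrR, pullbackG_eq N Q s hs hsS, pullbackG_eq N Q t ht htT, h1]
  refine Q.g_comp s t r p.1 hs ht' hr ?_
  have h2 : Tendsto (fun x : A.Chart i => (x, p.2)) (𝓝 p.1) (𝓝 p) :=
    (Continuous.prodMk_left p.2).tendsto p.1
  have h3 : Tendsto S (𝓝 p) (𝓝 (S p)) := S.continuousAt hS
  filter_upwards [h2.eventually hsS, h2.eventually hrR, h2.eventually hcomp,
    h2.eventually (h3.eventually htT)] with x e1 e2 e3 e4
  have e5 : N.circleLift r (x, p.2) = N.circleLift t (N.circleLift s (x, p.2)) := by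
    rw [← e2, e3, ← e1]
    exact e4
  exact congrArg Prod.fst e5

variable [I.Boundaryless] [CompleteSpace E] {h : N.HermitianMetric}

/-- Every coordinate change of the unit circle bundle is locally induced by a coordinate change of
the base. -/
theorem exists_eventuallyEq_circleLift {i j : A.Idx}
    (T : OpenPartialHomeomorph (A.Chart i × Circle) (A.Chart j × Circle))
    (hTs : ContMDiffOn (I.prod (𝓡 1)) (I.prod (𝓡 1)) ∞ T T.source)
    (hTp : ∀ p ∈ T.source, UnitCircleBundle.mk h j (T p).1 (T p).2 =
      UnitCircleBundle.mk h i p.1 p.2) {p : A.Chart i × Circle} (hp : p ∈ T.source) :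
    ∃ t : A.Change i j, p.1 ∈ t.map.source ∧ T =ᶠ[𝓝 p] N.circleLift t := by
  obtain ⟨s, hs, h1, h2⟩ := UnitCircleBundle.mk_eq_mk.1 (hTp p hp).symm
  have hpt : N.circleLift s p = T p := Prod.ext h1 h2
  have hpS : p ∈ (N.circleLift s).source := ⟨hs, mem_univ _⟩
  have hp2 : T p ∈ (N.circleLift s).target := hpt ▸ (N.circleLift s).map_source hpS
  let _ := UnitCircleBundle.mulAction N i
  have hf : FaithfulSMul (A.Grp i) (A.Chart i × Circle) := (N.unitCircleAtlas h).faithfulGrp i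
  obtain ⟨γ, hγ⟩ : ∃ γ : A.Grp i, (fun q => (N.circleLift s).symm (T q)) =ᶠ[𝓝 p]
      fun q => N.circleLift (Change.ofGrp γ) q := by
    refine eventuallyEq_smul_of_mem_orbit (I := I.prod (𝓡 1)) (G := A.Grp i)
      (fun γ => N.contMDiff_circleLift_ofGrp γ)
      (T.trans (N.circleLift s).symm).open_source
      ((N.contMDiffOn_circleLift_symm s).comp (hTs.mono fun q hq => hq.1) fun q hq => hq.2)
      ?_ (x := p) ⟨hp, hp2⟩
    rintro q ⟨hq1, hq2⟩
    have h3 : UnitCircleBundle.mk h i ((N.circleLift s).symm (T q)).1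
        ((N.circleLift s).symm (T q)).2 = UnitCircleBundle.mk h i q.1 q.2 := by
      rw [← hTp q hq1]
      have h4 := (N.circleLift s).right_inv hq2
      have h5 := (N.circleLift s).map_target hq2
      exact UnitCircleBundle.mk_eq_mk.2 ⟨s, h5.1, congrArg Prod.fst h4, congrArg Prod.snd h4⟩
    obtain ⟨γ, hγ⟩ := (UnitCircleBundle.mk_eq_mk_iff_exists_smul i _ _).1 h3.symm
    exact ⟨γ, hγ.symm⟩
  have hγ1 : (Change.ofGrp γ).map p.1 = p.1 := by
    have h3 := hγ.self_of_nhds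
    dsimp only at h3
    rw [← hpt, (N.circleLift s).left_inv hpS] at h3
    exact (congrArg Prod.fst h3).symm
  have hsrc : (Change.ofGrp γ).map p.1 ∈ s.map.source := by rw [hγ1]; exact hs
  refine ⟨(Change.ofGrp γ).trans s, ⟨mem_univ _, hsrc⟩, ?_⟩
  have hnear : ∀ᶠ q in 𝓝 p, q ∈ (T.trans (N.circleLift s).symm).source :=
    (T.trans (N.circleLift s).symm).open_source.mem_nhds ⟨hp, hp2⟩
  have hnear2 : ∀ᶠ q in 𝓝 p, q.1 ∈ ((Change.ofGrp γ).trans s).map.source :=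
    continuousAt_fst.eventually
      (((Change.ofGrp γ).trans s).map.open_source.mem_nhds ⟨mem_univ _, hsrc⟩)
  filter_upwards [hγ, hnear, hnear2] with q hq hn hn2
  have h6 : T q = N.circleLift s (N.circleLift (Change.ofGrp γ) q) := by
    rw [← hq]
    exact ((N.circleLift s).right_inv hn.2).symm
  rw [h6]
  simp only [circleLift_apply]
  rw [N.g_trans (Change.ofGrp γ) s (mem_univ _) hn2.2, phase_mul
    (a := N.g s ((Change.ofGrp γ).map q.1)) (N.g_ne_zero s _ hn2.2)
    (N.g_ne_zero (Change.ofGrp γ) _ (mem_univ _)), mul_assoc]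
  rfl

theorem contMDiffOn_pullbackG (N Q : LineOrbibundle A) (h : N.HermitianMetric) {i j : A.Idx}
    (T : OpenPartialHomeomorph (A.Chart i × Circle) (A.Chart j × Circle))
    (hTs : ContMDiffOn (I.prod (𝓡 1)) (I.prod (𝓡 1)) ∞ T T.source)
    (hTp : ∀ p ∈ T.source, UnitCircleBundle.mk h j (T p).1 (T p).2 =
      UnitCircleBundle.mk h i p.1 p.2) :
    ContMDiffOn (I.prod (𝓡 1)) 𝓘(ℝ, ℂ) ∞ (pullbackG N Q T) T.source := by
  intro p hp
  obtain ⟨t, ht, hT⟩ := exists_eventuallyEq_circleLift T hTs hTp hp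
  have h1 : ContMDiffAt (I.prod (𝓡 1)) 𝓘(ℝ, ℂ) ∞
      (fun p : A.Chart i × Circle => Q.g t p.1) p :=
    ((Q.smooth_g t).contMDiffAt (t.map.open_source.mem_nhds ht)).comp p contMDiffAt_fst
  refine (h1.congr_of_eventuallyEq ?_).contMDiffWithinAt
  have h2 : ∀ᶠ q : A.Chart i × Circle in 𝓝 p, q.1 ∈ t.map.source :=
    continuousAt_fst.eventually (t.map.open_source.mem_nhds ht)
  filter_upwards [hT.eventuallyEq_nhds, h2] with q h3 h4
  exact pullbackG_eq N Q t h4 h3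

/-- The pullback `(p|_L)^* Q` of a line orbibundle on `D` to the unit circle bundle `L` of `N`. Its
local form is `Chart i × S¹ × ℂ`, and its transition functions are the transition functions of `Q`,
pulled back under the projections `Chart i × S¹ → Chart i`. -/
def pullback (Q : LineOrbibundle A) (h : N.HermitianMetric) :
    LineOrbibundle (N.unitCircleAtlas h) where
  g T p := pullbackG N Q T.map p
  g_ne_zero T p hp := by
    obtain ⟨t, ht, hT⟩ := exists_eventuallyEq_circleLift T.map T.smooth T.proj_map hp
    rw [pullbackG_eq N Q t ht hT]
    exact Q.g_ne_zero t _ ht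
  smooth_g T := contMDiffOn_pullbackG N Q h T.map T.smooth T.proj_map
  g_comp S T R _ hS hT hR hcomp := pullbackG_comp N Q hS hcomp
    (exists_eventuallyEq_circleLift S.map S.smooth S.proj_map hS)
    (exists_eventuallyEq_circleLift T.map T.smooth T.proj_map hT)
    (exists_eventuallyEq_circleLift R.map R.smooth R.proj_map hR)

end Pullback

end LineOrbibundle

end

/-!
Over a uniformizing chart, a trivialization of the pullback of `Q` to the unit circle bundle `L` is
a smooth nowhere zero function `e i (x, z)` on `Chart i × S¹`, and compatibility with a coordinate
change `t` of the base reads `g_Q(x) * e j (t x, u * z) = e i (x, z)`, where `u = g_N(x) / |g_N(x)|`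
(`isTrivial_pullback_iff`).

Given such a family, the degree of `z ↦ e i (x, z)` is unaffected by rotating `z` and by multiplying
with nonzero constants, and it is locally constant in `x`. As `D` is connected it is a constant `d`
(`exists_forall_circleDegree_eq`). Then `e i (x, z) * z ^ (-d)` has a continuous logarithm on each
circle, unique up to constants in `2πiℤ`, so its geometric mean `m i (x)` over the circle is well
defined. By rotation invariance of the mean, `g_Q(x) * u ^ d * m j (t x) = m i (x)`
(`circleGeomMean_mul_rotate`), and `m i` is smooth (`contMDiff_circleGeomMean`). The length `s i` of
the local frame of `N` satisfies `s j (t x) * g_N(x) = s i (x) * u`, so that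
`E i = m i * (s i) ^ d` satisfies `E j (t x) * g_Q(x) = g_N(x) ^ (-d) * E i (x)`. This is an
isomorphism from `Q` to `N ^ (-d)`.

Conversely, an isomorphism `E` from `Q` to `N ^ (-a)` gives the trivialization
`e i (x, z) = z ^ a * E i (x) * s i (x) ^ (-a)`.
-/

noncomputable section

/-! ### Smooth complex valued functions -/

section

variable {E : Type*} [NormedAddCommGroup E] [NormedSpace ℝ E]
  {H : Type*} [TopologicalSpace H] {I : ModelWithCorners ℝ E H}
  {M : Type*} [TopologicalSpace M] [ChartedSpace H M]

theorem contMDiffAt_mul_complex {f g : M → ℂ} {x : M} (hf : ContMDiffAt I 𝓘(ℝ, ℂ) ∞ f x)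
    (hg : ContMDiffAt I 𝓘(ℝ, ℂ) ∞ g x) : ContMDiffAt I 𝓘(ℝ, ℂ) ∞ (fun y => f y * g y) x :=
  ContMDiffAt.comp (g := fun p : ℂ × ℂ => p.1 * p.2) x
    (contDiff_fst.mul contDiff_snd).contDiffAt.contMDiffAt (hf.prodMk_space hg)

theorem contMDiffAt_div_complex {f g : M → ℂ} {x : M} (hf : ContMDiffAt I 𝓘(ℝ, ℂ) ∞ f x)
    (hg : ContMDiffAt I 𝓘(ℝ, ℂ) ∞ g x) (h0 : g x ≠ 0) :
    ContMDiffAt I 𝓘(ℝ, ℂ) ∞ (fun y => f y / g y) x := by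
  simp only [div_eq_mul_inv]
  exact contMDiffAt_mul_complex hf (((contDiffAt_inv ℝ h0).contMDiffAt).comp x hg)

end

theorem contDiffAt_zpow_complex (k : ℤ) {w : ℂ} (hw : w ≠ 0) :
    ContDiffAt ℝ ∞ (fun v : ℂ => v ^ k) w := by
  rcases k with k | k
  · simpa using (contDiff_id.pow k).contDiffAt
  · simp only [zpow_negSucc]
    exact ((contDiff_id.pow (k + 1)).contDiffAt).inv (pow_ne_zero _ hw)

theorem contMDiff_circle_coe : ContMDiff (𝓡 1) 𝓘(ℝ, ℂ) ∞ (fun z : Circle => (z : ℂ)) :=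
  have : Fact (Module.finrank ℝ ℂ = 1 + 1) := finrank_real_complex_fact'
  contMDiff_coe_sphere (E := ℂ) (n := 1)

/-! ### Smooth parametric integrals -/

/-- An integral over a bounded interval depends smoothly on the parameters. It is a convolution,
evaluated at `0`, of the indicator function of the interval with the integrand, cut off by a
bump function. -/
theorem contDiffOn_intervalIntegral_param {P F : Type*} [NormedAddCommGroup P] [NormedSpace ℝ P]
    [NormedAddCommGroup F] [NormedSpace ℝ F] [CompleteSpace F]
    {f : P → ℝ → F} {s : Set P} (hs : IsOpen s) (a b : ℝ)
    (hf : ContDiffOn ℝ ∞ (fun q : P × ℝ => f q.1 q.2) (s ×ˢ univ)) :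
    ContDiffOn ℝ ∞ (fun p => ∫ θ in a..b, f p θ) s := by
  set R : ℝ := |a| + |b| + 1 with hR
  have hRpos : 0 < R := by positivity
  let χ : ContDiffBump (0 : ℝ) := ⟨R, R + 1, hRpos, by linarith⟩
  have key : ∀ a' b' : ℝ, |a'| ≤ R → |b'| ≤ R →
      ContDiffOn ℝ ∞ (fun p => ∫ θ in Ioc a' b', f p θ) s := by
    intro a' b' ha hb
    have h1 := MeasureTheory.contDiffOn_convolution_right_with_param (n := ⊤)
      (μ := MeasureTheory.volume)
      (f := (Ioc a' b').indicator (fun _ => (1 : ℝ))) (ContinuousLinearMap.lsmul ℝ ℝ)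
      (g := fun p y => χ y • f p (-y)) (s := s) (k := Metric.closedBall 0 (R + 1))
      hs (isCompact_closedBall _ _)
      (fun p y _ hy => by
        rw [χ.zero_of_le_dist (by
          change R + 1 ≤ dist y 0
          exact (not_le.1 hy).le), zero_smul])
      ((MeasureTheory.integrable_indicator_iff measurableSet_Ioc).2
        (by simp)).locallyIntegrable
      (by
        refine ContDiffOn.smul (χ.contDiff.comp contDiff_snd).contDiffOn ?_
        exact hf.comp (contDiff_fst.prodMk contDiff_snd.neg).contDiffOn
          fun q hq => ⟨hq.1, mem_univ _⟩)
    have h2 := ContDiffOn.comp (s := s) (f := fun p : P => (p, (0 : ℝ))) h1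
      (contDiff_id.prodMk contDiff_const).contDiffOn fun p hp => ⟨hp, mem_univ _⟩
    refine h2.congr fun p hp => ?_
    change _ = ∫ t, _
    rw [← MeasureTheory.integral_indicator measurableSet_Ioc]
    refine MeasureTheory.integral_congr_ae (Eventually.of_forall fun t => ?_)
    by_cases ht : t ∈ Ioc a' b'
    · have h3 : χ (0 - t) = 1 := χ.one_of_mem_closedBall (by
        change dist (0 - t) 0 ≤ R
        rw [dist_zero_right, zero_sub, norm_neg, Real.norm_eq_abs]
        exact abs_le.2 ⟨by linarith [ht.1, neg_le_of_abs_le ha], ht.2.trans (le_of_abs_le hb)⟩)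
      dsimp only
      rw [indicator_of_mem ht, ContinuousLinearMap.lsmul_apply, h3,
        one_smul, indicator_of_mem ht, one_smul, zero_sub, neg_neg]
    · simp [ht]
  -- The interval integral is the difference of the integrals over `Ioc a b` and `Ioc b a`.
  have ha : |a| ≤ R := by rw [hR]; linarith [abs_nonneg b]
  have hb : |b| ≤ R := by rw [hR]; linarith [abs_nonneg a]
  exact (key a b ha hb).sub (key b a hb ha)

/-! ### Means over the unit circle -/

/-- The mean of a function on the unit circle with respect to the rotation invariant probability
measure. -/
def circleMean (l : Circle → ℂ) : ℂ :=
  (2 * Real.pi : ℝ)⁻¹ • ∫ θ in (0 : ℝ)..2 * Real.pi, l (Circle.exp θ)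

theorem circleMean_const (c : ℂ) : circleMean (fun _ => c) = c := by
  simp only [circleMean, intervalIntegral.integral_const, sub_zero]
  exact inv_smul_smul₀ Real.two_pi_pos.ne' c

theorem circleMean_add {l m : Circle → ℂ} (hl : Continuous l) (hm : Continuous m) :
    circleMean (fun z => l z + m z) = circleMean l + circleMean m := by
  simp only [circleMean]
  rw [intervalIntegral.integral_add, smul_add]
  · exact (hl.comp Circle.exp.continuous).intervalIntegrable _ _
  · exact (hm.comp Circle.exp.continuous).intervalIntegrable _ _

theorem circleMean_rotate (l : Circle → ℂ) (u : Circle) :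
    circleMean (fun z => l (u * z)) = circleMean l := by
  obtain ⟨c, rfl⟩ : ∃ c : ℝ, Circle.exp c = u := ⟨_, Circle.exp_arg u⟩
  simp only [circleMean, ← Circle.exp_add]
  congr 1
  rw [intervalIntegral.integral_comp_add_left (fun θ => l (Circle.exp θ)), add_zero]
  exact Function.Periodic.intervalIntegral_add_eq (f := fun θ => l (Circle.exp θ))
    (fun θ => congrArg l (Circle.periodic_exp θ)) c 0 |>.trans (by rw [zero_add])

section

variable {E : Type*} [NormedAddCommGroup E] [NormedSpace ℝ E]
  {H : Type*} [TopologicalSpace H] {I : ModelWithCorners ℝ E H} [I.Boundaryless]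
  {M : Type*} [TopologicalSpace M] [ChartedSpace H M] [IsManifold I ∞ M]

theorem contMDiffAt_circleMean {G : M × Circle → ℂ} {V : Set M} (hV : IsOpen V)
    (hG : ContMDiffOn (I.prod (𝓡 1)) 𝓘(ℝ, ℂ) ∞ G (V ×ˢ univ)) {x : M} (hx : x ∈ V) :
    ContMDiffAt I 𝓘(ℝ, ℂ) ∞ (fun y => circleMean fun z => G (y, z)) x := by
  set φ := extChartAt I x with hφ
  set s : Set E := φ.target ∩ φ.symm ⁻¹' V
  have hso : IsOpen s :=
    (continuousOn_extChartAt_symm x).isOpen_inter_preimage (isOpen_extChartAt_target x) hV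
  have h1 : ContDiffOn ℝ ∞ (fun q : E × ℝ => G (φ.symm q.1, Circle.exp q.2)) (s ×ˢ univ) := by
    rw [← contMDiffOn_iff_contDiffOn]
    refine hG.comp (ContMDiffOn.prodMk ?_ ?_) fun q hq => ⟨hq.1.2, mem_univ _⟩
    · exact (contMDiffOn_extChartAt_symm x).comp contDiff_fst.contMDiff.contMDiffOn
        fun q hq => hq.1.1
    · exact (contMDiff_circleExp.comp contDiff_snd.contMDiff).contMDiffOn
  have h2 := (contDiffOn_intervalIntegral_param (f := fun p θ => G (φ.symm p, Circle.exp θ))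
    hso 0 (2 * Real.pi) h1).const_smul (2 * Real.pi : ℝ)⁻¹
  have hxs : φ x ∈ s := ⟨mem_extChartAt_target x, by
    rw [mem_preimage, hφ, extChartAt_to_inv]; exact hx⟩
  have h3 := (h2.contDiffAt (hso.mem_nhds hxs)).contMDiffAt.comp x
    (contMDiffAt_extChartAt (I := I) (n := ∞) (x := x))
  refine h3.congr_of_eventuallyEq ?_
  filter_upwards [extChartAt_source_mem_nhds (I := I) x] with y hy
  simp only [Function.comp_apply, circleMean, hφ]
  rw [(extChartAt I x).left_inv hy]

end

/-! ### Degree and geometric mean of a nowhere zero function on the circle -/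

/-- The function `φ` on the circle has degree `d`, and `l` is a continuous logarithm of
`φ z * z ^ (-d)`. -/
structure IsCircleLog (φ : Circle → ℂ) (d : ℤ) (l : Circle → ℂ) : Prop where
  continuous : Continuous l
  eq_mul_exp : ∀ z : Circle, φ z = (z : ℂ) ^ d * Complex.exp (l z)

theorem exists_real_log {f : ℝ → ℂ} (hf : Continuous f) (h0 : ∀ θ, f θ ≠ 0) :
    ∃ L : ℝ → ℂ, Continuous L ∧ ∀ θ, Complex.exp (L θ) = f θ := by
  have hsc : IsSimplyConnected (univ : Set ℝ) := by
    have : ContractibleSpace (univ : Set ℝ) := convex_univ.contractibleSpace univ_nonempty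
    exact SimplyConnectedSpace.ofContractible _
  obtain ⟨L, hL, hE⟩ := Complex.exists_continuousOn_eqOn_exp_comp hsc isOpen_univ hf.continuousOn
    (by rintro ⟨θ, -, hθ⟩; exact h0 θ hθ)
  exact ⟨L, continuousOn_univ.1 hL, fun θ => hE (mem_univ θ)⟩

theorem eq_of_continuous_of_exp_eq_one {f : ℝ → ℂ} (hf : Continuous f)
    (h : ∀ θ, Complex.exp (f θ) = 1) (θ θ' : ℝ) : f θ = f θ' := by
  choose n hn using fun θ => Complex.exp_eq_one_iff.1 (h θ)
  have hc : Continuous n := by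
    refine Int.isClosedEmbedding_coe_real.isEmbedding.continuous_iff.2 ?_
    refine (Complex.continuous_re.comp (hf.div_const (2 * Real.pi * Complex.I))).congr fun θ => ?_
    rw [Function.comp_apply, hn, mul_div_cancel_right₀ _ Complex.two_pi_I_ne_zero]
    simp
  rw [hn θ, hn θ', PreconnectedSpace.constant inferInstance hc]

/-- A logarithm of `θ ↦ φ (exp (i θ))` on the line grows by `2πi d` over a period; once the linear
term `i d θ` is subtracted it descends to the circle. -/
theorem exists_isCircleLog {φ : Circle → ℂ} (hφ : Continuous φ) (h0 : ∀ z, φ z ≠ 0) :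
    ∃ d l, IsCircleLog φ d l := by
  obtain ⟨L, hL, hE⟩ := exists_real_log (hφ.comp Circle.exp.continuous) fun θ => h0 _
  have hper : ∀ θ, Complex.exp (L (θ + 2 * Real.pi) - L θ) = 1 := fun θ => by
    rw [Complex.exp_sub, hE, hE, Function.comp_apply, Function.comp_apply, Circle.periodic_exp θ,
      div_self (h0 _)]
  obtain ⟨d, hd⟩ := Complex.exp_eq_one_iff.1 (hper 0)
  have hd' : ∀ θ, L (θ + 2 * Real.pi) = L θ + d * (2 * Real.pi * Complex.I) := fun θ => by
    have := eq_of_continuous_of_exp_eq_one (f := fun θ => L (θ + 2 * Real.pi) - L θ)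
      (by fun_prop) hper θ 0
    rw [← hd, ← this]; ring
  have hq : IsQuotientMap Circle.exp :=
    isLocalHomeomorph_circleExp.isOpenMap.isQuotientMap Circle.exp.continuous
      fun z => ⟨_, Circle.exp_arg z⟩
  set m : ℝ → ℂ := fun θ => L θ - d * (θ * Complex.I) with hm
  have hmc : Continuous m := by fun_prop
  have hmp : Function.Periodic m (2 * Real.pi) := fun θ => by
    simp only [hm, hd']; push_cast; ring
  refine ⟨d, fun z => m (Complex.arg z), hq.continuous_iff.2 ?_, fun z => ?_⟩
  · refine hmc.congr fun θ => ?_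
    obtain ⟨k, hk⟩ := Circle.exp_eq_exp.1 (Circle.exp_arg (Circle.exp θ))
    simp only [Function.comp_apply]
    rw [hk]
    exact (hmp.int_mul k θ).symm
  · have h1 : φ z = Complex.exp (L (Complex.arg z)) := by
      rw [hE, Function.comp_apply, Circle.exp_arg]
    have h2 : (z : ℂ) = Complex.exp (Complex.arg z * Complex.I) := by
      conv_lhs => rw [← Circle.exp_arg z, Circle.coe_exp]
    rw [h1, hm]
    nth_rewrite 2 [h2]
    rw [← Complex.exp_int_mul, ← Complex.exp_add]
    congr 1; ring

namespace IsCircleLog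

variable {φ ψ : Circle → ℂ} {d d' : ℤ} {l l' : Circle → ℂ}

/-- The logarithm is unique up to a constant in `2πiℤ`, so the exponential of its mean is well
defined. -/
theorem unique (h : IsCircleLog φ d l) (h' : IsCircleLog φ d' l') :
    d = d' ∧ Complex.exp (circleMean l) = Complex.exp (circleMean l') := by
  have hexp : ∀ θ : ℝ, Complex.exp (l (Circle.exp θ) - l' (Circle.exp θ) +
      (d - d') * (θ * Complex.I)) = 1 := fun θ => by
    have h1 := (h.eq_mul_exp (Circle.exp θ)).symm.trans (h'.eq_mul_exp (Circle.exp θ))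
    rw [Circle.coe_exp, ← Complex.exp_int_mul, ← Complex.exp_int_mul, ← Complex.exp_add,
      ← Complex.exp_add] at h1
    rw [← div_eq_one_iff_eq (Complex.exp_ne_zero _), ← Complex.exp_sub] at h1
    rw [← h1]; congr 1; ring
  have hl := h.continuous
  have hl' := h'.continuous
  have hconst := eq_of_continuous_of_exp_eq_one (by fun_prop) hexp
  have hdd : d = d' := by
    have h1 := hconst (2 * Real.pi) 0
    rw [Circle.exp_two_pi, Circle.exp_zero] at h1
    have h2 : ((d : ℂ) - d') * (2 * Real.pi * Complex.I) = 0 := by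
      push_cast at h1
      linear_combination h1
    rcases mul_eq_zero.1 h2 with h3 | h3
    · exact_mod_cast sub_eq_zero.1 h3
    · exact absurd h3 Complex.two_pi_I_ne_zero
  subst hdd
  refine ⟨rfl, ?_⟩
  set c := l 1 - l' 1 with hc
  have h1 : l = fun z => l' z + c := by
    ext z
    have h2 := hconst (Complex.arg z) 0
    rw [Circle.exp_arg, Circle.exp_zero] at h2
    simp only [sub_self, zero_mul, add_zero] at h2
    rw [hc, ← h2]; ring
  have h3 : Complex.exp c = 1 := by simpa using hexp 0
  rw [h1, circleMean_add hl' continuous_const, circleMean_const, Complex.exp_add, h3, mul_one]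

theorem mul_rotate (h : IsCircleLog φ d l) (u : Circle) {b a : ℂ}
    (hab : Complex.exp a = b * (u : ℂ) ^ d) :
    IsCircleLog (fun z => b * φ (u * z)) d (fun z => l (u * z) + a) where
  continuous := (h.continuous.comp (continuous_const.mul continuous_id)).add continuous_const
  eq_mul_exp z := by
    rw [h.eq_mul_exp, Complex.exp_add, hab, Circle.coe_mul, mul_zpow]
    ring

theorem mul_exp (h : IsCircleLog φ d l) {m : Circle → ℂ} (hm : Continuous m)
    (hψ : ∀ z, ψ z = φ z * Complex.exp (m z)) : IsCircleLog ψ d (fun z => l z + m z) where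
  continuous := h.continuous.add hm
  eq_mul_exp z := by rw [hψ, h.eq_mul_exp, Complex.exp_add, mul_assoc]

end IsCircleLog

open scoped Classical in
/-- The degree (winding number around `0`) of a continuous nowhere zero function on the circle, and
`0` for other functions. -/
def circleDegree (φ : Circle → ℂ) : ℤ :=
  if h : ∃ d l, IsCircleLog φ d l then h.choose else 0

open scoped Classical in
/-- The geometric mean of `φ z * z ^ (-d)` over the circle, for a continuous nowhere zero function
`φ` of degree `d`; it is `0` for other functions. -/
def circleGeomMean (φ : Circle → ℂ) : ℂ :=
  if h : ∃ d l, IsCircleLog φ d l then Complex.exp (circleMean h.choose_spec.choose) else 0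

namespace IsCircleLog

variable {φ : Circle → ℂ} {d : ℤ} {l : Circle → ℂ}

theorem circleDegree_eq (h : IsCircleLog φ d l) : circleDegree φ = d := by
  have hex : ∃ d l, IsCircleLog φ d l := ⟨d, l, h⟩
  rw [circleDegree, dif_pos hex]
  exact (hex.choose_spec.choose_spec.unique h).1

theorem circleGeomMean_eq (h : IsCircleLog φ d l) :
    circleGeomMean φ = Complex.exp (circleMean l) := by
  have hex : ∃ d l, IsCircleLog φ d l := ⟨d, l, h⟩
  rw [circleGeomMean, dif_pos hex]
  exact (hex.choose_spec.choose_spec.unique h).2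

end IsCircleLog

theorem circleGeomMean_ne_zero {φ : Circle → ℂ} (hφ : Continuous φ) (h0 : ∀ z, φ z ≠ 0) :
    circleGeomMean φ ≠ 0 := by
  obtain ⟨d, l, h⟩ := exists_isCircleLog hφ h0
  rw [h.circleGeomMean_eq]
  exact Complex.exp_ne_zero _

theorem circleDegree_mul_rotate {φ : Circle → ℂ} (hφ : Continuous φ) (h0 : ∀ z, φ z ≠ 0)
    {b : ℂ} (hb : b ≠ 0) (u : Circle) :
    circleDegree (fun z => b * φ (u * z)) = circleDegree φ := by
  obtain ⟨d, l, h⟩ := exists_isCircleLog hφ h0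
  rw [h.circleDegree_eq, (h.mul_rotate u (Complex.exp_log (x := b * (u : ℂ) ^ d)
    (mul_ne_zero hb (zpow_ne_zero _ u.coe_ne_zero)))).circleDegree_eq]

theorem circleGeomMean_mul_rotate {φ : Circle → ℂ} (hφ : Continuous φ) (h0 : ∀ z, φ z ≠ 0)
    {b : ℂ} (hb : b ≠ 0) (u : Circle) :
    circleGeomMean (fun z => b * φ (u * z)) =
      b * (u : ℂ) ^ circleDegree φ * circleGeomMean φ := by
  obtain ⟨d, l, h⟩ := exists_isCircleLog hφ h0
  have hab := Complex.exp_log (x := b * (u : ℂ) ^ d)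
    (mul_ne_zero hb (zpow_ne_zero _ u.coe_ne_zero))
  rw [h.circleDegree_eq, h.circleGeomMean_eq, (h.mul_rotate u hab).circleGeomMean_eq,
    circleMean_add (l := fun z => l (u * z))
      (h.continuous.comp (continuous_const.mul continuous_id)) continuous_const,
    circleMean_const, circleMean_rotate l u, Complex.exp_add, hab, mul_comm]

/-! ### Families of functions on the circle -/

section

variable {E : Type*} [NormedAddCommGroup E] [NormedSpace ℝ E]
  {H : Type*} [TopologicalSpace H] {I : ModelWithCorners ℝ E H}
  {M : Type*} [TopologicalSpace M] [ChartedSpace H M] {F : M × Circle → ℂ}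

/-- By compactness of the circle, nearby fibres of `F` have a quotient with values in the domain of
the principal logarithm. This makes the degree locally constant and reduces the smoothness of the
geometric mean to that of the mean of a smooth logarithm. -/
theorem exists_nhds_div_mem_slitPlane (hF : Continuous F) (h0 : ∀ p, F p ≠ 0) (x : M) :
    ∃ V : Set M, IsOpen V ∧ x ∈ V ∧ ∀ y ∈ V, ∀ z, F (y, z) / F (x, z) ∈ Complex.slitPlane := by
  have hc : Continuous fun p : M × Circle => F p / F (x, p.2) :=
    hF.div (hF.comp (continuous_const.prodMk continuous_snd)) fun p => h0 _
  have h1 : ∀ᶠ y in 𝓝 x, ∀ z ∈ (univ : Set Circle), F (y, z) / F (x, z) ∈ Complex.slitPlane := by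
    refine isCompact_univ.eventually_forall_of_forall_eventually fun z _ => ?_
    refine hc.continuousAt.eventually (Complex.isOpen_slitPlane.mem_nhds ?_)
    change F (x, z) / F (x, z) ∈ _
    rw [div_self (h0 _)]
    exact Complex.one_mem_slitPlane
  obtain ⟨V, hV, hVo, hxV⟩ := eventually_nhds_iff.1 h1
  exact ⟨V, hVo, hxV, fun y hy z => hV y hy z (mem_univ z)⟩

theorem IsCircleLog.of_div_mem_slitPlane (hF : Continuous F) (h0 : ∀ p, F p ≠ 0) {x y : M}
    (h : ∀ z, F (y, z) / F (x, z) ∈ Complex.slitPlane) {d : ℤ} {l : Circle → ℂ}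
    (hl : IsCircleLog (fun z => F (x, z)) d l) :
    Continuous (fun z => Complex.log (F (y, z) / F (x, z))) ∧
    IsCircleLog (fun z => F (y, z)) d (fun z => l z + Complex.log (F (y, z) / F (x, z))) := by
  have hc : Continuous fun z => Complex.log (F (y, z) / F (x, z)) :=
    Continuous.clog ((hF.comp (Continuous.prodMk_right y)).div
      (hF.comp (Continuous.prodMk_right x)) fun z => h0 _) h
  refine ⟨hc, hl.mul_exp hc fun z => ?_⟩
  rw [Complex.exp_log (div_ne_zero (h0 _) (h0 _)), mul_div_cancel₀ _ (h0 _)]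

theorem eventually_circleDegree_eq (hF : Continuous F) (h0 : ∀ p, F p ≠ 0) (x : M) :
    ∀ᶠ y in 𝓝 x, circleDegree (fun z => F (y, z)) = circleDegree (fun z => F (x, z)) := by
  obtain ⟨V, hVo, hxV, hV⟩ := exists_nhds_div_mem_slitPlane hF h0 x
  obtain ⟨d, l, hl⟩ := exists_isCircleLog (hF.comp (Continuous.prodMk_right x)) fun z => h0 _
  filter_upwards [hVo.mem_nhds hxV] with y hy
  rw [(IsCircleLog.of_div_mem_slitPlane hF h0 (hV y hy) hl).2.circleDegree_eq]
  exact hl.circleDegree_eq.symm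

theorem contMDiff_circleGeomMean [I.Boundaryless] [IsManifold I ∞ M]
    (hF : ContMDiff (I.prod (𝓡 1)) 𝓘(ℝ, ℂ) ∞ F) (h0 : ∀ p, F p ≠ 0) :
    ContMDiff I 𝓘(ℝ, ℂ) ∞ (fun x => circleGeomMean fun z => F (x, z)) := by
  intro x
  obtain ⟨V, hVo, hxV, hV⟩ := exists_nhds_div_mem_slitPlane hF.continuous h0 x
  obtain ⟨d, l, hl⟩ := exists_isCircleLog (hF.continuous.comp (Continuous.prodMk_right x))
    fun z => h0 _
  have hG : ContMDiffOn (I.prod (𝓡 1)) 𝓘(ℝ, ℂ) ∞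
      (fun p : M × Circle => Complex.log (F p / F (x, p.2))) (V ×ˢ univ) := by
    rintro ⟨y, z⟩ ⟨hy, -⟩
    have h1 : ContDiffAt ℝ ∞ Complex.log (F (y, z) / F (x, z)) :=
      (Complex.contDiffAt_log (hV y hy z)).restrict_scalars ℝ
    have h2 : ContMDiff (I.prod (𝓡 1)) 𝓘(ℝ, ℂ) ∞ (fun p : M × Circle => F p / F (x, p.2)) := by
      have h3 : ContMDiff (I.prod (𝓡 1)) 𝓘(ℝ, ℂ) ∞ (fun p : M × Circle => F (x, p.2)) :=
        hF.comp (contMDiff_const.prodMk contMDiff_snd)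
      exact fun p => contMDiffAt_div_complex (hF p) (h3 p) (h0 _)
    exact (h1.contMDiffAt.comp (y, z) (h2 (y, z))).contMDiffWithinAt
  have h4 : ContMDiffAt I 𝓘(ℝ, ℂ) ∞ (fun y => Complex.exp (circleMean l) *
      Complex.exp (circleMean fun z => Complex.log (F (y, z) / F (x, z)))) x :=
    contMDiffAt_mul_complex contMDiffAt_const
      ((Complex.contDiff_exp (𝕜 := ℝ)).contDiffAt.contMDiffAt.comp x
        (contMDiffAt_circleMean hVo hG hxV))
  refine h4.congr_of_eventuallyEq ?_
  filter_upwards [hVo.mem_nhds hxV] with y hy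
  obtain ⟨hc, hly⟩ := IsCircleLog.of_div_mem_slitPlane hF.continuous h0 (hV y hy) hl
  rw [hly.circleGeomMean_eq, circleMean_add hl.continuous hc, Complex.exp_add]

end

open OrbifoldAtlas

namespace LineOrbibundle

variable {E : Type*} [NormedAddCommGroup E] [NormedSpace ℝ E]
  {H : Type*} [TopologicalSpace H] {I : ModelWithCorners ℝ E H}
  {D : Type u} [TopologicalSpace D] {A : OrbifoldAtlas I D} {N Q : LineOrbibundle A}

/-! ### The length of the local frames -/

/-- The length of the local frame over the chart `i`. -/
def HermitianMetric.frameNorm (h : N.HermitianMetric) (i : A.Idx) (x : A.Chart i) : ℝ :=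
  √(h.weight i x)

namespace HermitianMetric

variable (h : N.HermitianMetric)

theorem frameNorm_pos (i : A.Idx) (x : A.Chart i) : 0 < h.frameNorm i x :=
  Real.sqrt_pos.2 (h.weight_pos i x)

theorem frameNorm_ne_zero (i : A.Idx) (x : A.Chart i) : (h.frameNorm i x : ℂ) ≠ 0 := by
  exact_mod_cast (h.frameNorm_pos i x).ne'

theorem frameNorm_map {i j : A.Idx} (t : A.Change i j) {x : A.Chart i} (hx : x ∈ t.map.source) :
    h.frameNorm j (t.map x) * ‖N.g t x‖ = h.frameNorm i x := by
  simp only [frameNorm]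
  rw [← h.weight_map t x hx, Real.sqrt_mul (h.weight_pos _ _).le, Real.sqrt_sq (norm_nonneg _)]

theorem frameNorm_map_mul_g {i j : A.Idx} (t : A.Change i j) {x : A.Chart i}
    (hx : x ∈ t.map.source) :
    (h.frameNorm j (t.map x) : ℂ) * N.g t x = h.frameNorm i x * (phase (N.g t x) : ℂ) := by
  rw [← h.frameNorm_map t hx]
  nth_rewrite 1 [← norm_mul_phase (N.g t x)]
  push_cast
  ring

theorem contMDiff_frameNorm_zpow (i : A.Idx) (k : ℤ) :
    ContMDiff I 𝓘(ℝ, ℂ) ∞ (fun x => (h.frameNorm i x : ℂ) ^ k) := by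
  intro x
  have h1 : ContMDiffAt I 𝓘(ℝ, ℝ) ∞ (h.frameNorm i) x :=
    (Real.contDiffAt_sqrt (h.weight_pos i x).ne').contMDiffAt.comp x (h.smooth_weight i x)
  have h2 : ContMDiffAt I 𝓘(ℝ, ℂ) ∞ (fun x => (h.frameNorm i x : ℂ)) x :=
    Complex.ofRealCLM.contDiff.contDiffAt.contMDiffAt.comp x h1
  exact (contDiffAt_zpow_complex k (h.frameNorm_ne_zero i x)).contMDiffAt.comp x h2

end HermitianMetric

/-! ### Trivializations of the pullback -/

/-- The fibrewise degree of a trivialization does not change under coordinate changes, so it is a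
function on `D`; it is locally constant, hence constant. -/
theorem exists_forall_circleDegree_eq [PreconnectedSpace D]
    {e : ∀ i : A.Idx, A.Chart i × Circle → ℂ} (he : ∀ i, Continuous (e i))
    (h0 : ∀ i p, e i p ≠ 0)
    (hc : ∀ (i j : A.Idx) (t : A.Change i j), ∀ x ∈ t.map.source, ∀ z : Circle,
        Q.g t x * e j (t.map x, phase (N.g t x) * z) = e i (x, z)) :
    ∃ d : ℤ, ∀ i x, circleDegree (fun z => e i (x, z)) = d := by
  have hinv : ∀ i j (x : A.Chart i) (y : A.Chart j), A.proj i x = A.proj j y →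
      circleDegree (fun z => e i (x, z)) = circleDegree (fun z => e j (y, z)) := by
    intro i j x y hxy
    obtain ⟨t, hx, rfl⟩ := exists_change hxy
    rw [← funext (hc i j t x hx)]
    exact circleDegree_mul_rotate ((he j).comp (Continuous.prodMk_right _)) (fun z => h0 _ _)
      (Q.g_ne_zero t x hx) _
  -- `ξ p` is a preimage of `p` in the chart `ι p`; by `hinv` the degree does not depend on it.
  choose ι ξ hξ using A.cover
  obtain ⟨d, hd⟩ := IsLocallyConstant.exists_eq_const
    (f := fun p : D => circleDegree fun z => e (ι p) (ξ p, z))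
    ((IsLocallyConstant.iff_eventually_eq _).2 fun p => by
      rw [← hξ p]
      refine ((A.isOpenMap_proj (ι p)).nhds_le (ξ p)) ?_
      rw [Filter.mem_map]
      filter_upwards [eventually_circleDegree_eq (he (ι p)) (h0 (ι p)) (ξ p)] with y hy
      rw [mem_preimage, mem_ofPred_eq, hξ p, hinv _ _ _ _ (hξ (A.proj (ι p) y)), hy])
  refine ⟨d, fun i x => ?_⟩
  rw [hinv _ _ _ _ (hξ (A.proj i x)).symm]
  exact congrFun hd _

section Boundaryless

variable [I.Boundaryless] [CompleteSpace E] {h : N.HermitianMetric}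

/-- The coordinate change `(x, z) ↦ (t x, (g t x / |g t x|) * z)` of the unit circle bundle that is
induced by the coordinate change `t` of the base. -/
def circleChange (h : N.HermitianMetric) {i j : A.Idx} (t : A.Change i j) :
    (N.unitCircleAtlas h).Change i j where
  map := N.circleLift t
  smooth := N.contMDiffOn_circleLift t
  smooth_symm := N.contMDiffOn_circleLift_symm t
  proj_map _ hp := (UnitCircleBundle.mk_eq_mk.2 ⟨t, hp.1, rfl, rfl⟩).symm

theorem pullback_g_circleChange (Q : LineOrbibundle A) {i j : A.Idx} (t : A.Change i j)
    {x : A.Chart i} (hx : x ∈ t.map.source) (z : Circle) :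
    (pullback Q h).g (circleChange h t) (x, z) = Q.g t x :=
  pullbackG_eq N Q t hx EventuallyEq.rfl

/-- A trivialization of the pullback only has to be compatible with the coordinate changes of the
unit circle bundle that are induced by coordinate changes of the base, since every other one is
locally of this form. -/
theorem isTrivial_pullback_iff : (pullback Q h).IsTrivial ↔
    ∃ e : ∀ i : A.Idx, A.Chart i × Circle → ℂ,
      (∀ i, ContMDiff (I.prod (𝓡 1)) 𝓘(ℝ, ℂ) ∞ (e i)) ∧ (∀ i p, e i p ≠ 0) ∧
      ∀ (i j : A.Idx) (t : A.Change i j), ∀ x ∈ t.map.source, ∀ z : Circle,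
        Q.g t x * e j (t.map x, phase (N.g t x) * z) = e i (x, z) := by
  constructor
  · rintro ⟨e, he, h0, hc⟩
    refine ⟨e, he, h0, fun i j t x hx z => ?_⟩
    have h1 := hc i j (circleChange h t) (x, z) ⟨hx, mem_univ _⟩
    rw [pullback_g_circleChange Q t hx] at h1
    rw [mul_comm]
    exact h1.trans (one_mul _)
  · rintro ⟨e, he, h0, hc⟩
    refine ⟨e, he, h0, fun (i j : A.Idx) T (p : A.Chart i × Circle) hp => ?_⟩
    obtain ⟨t, ht, hT⟩ := exists_eventuallyEq_circleLift T.map T.smooth T.proj_map hp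
    change e j (T.map p) * pullbackG N Q T.map p = 1 * e i p
    rw [pullbackG_eq N Q t ht hT, one_mul, ← hc i j t p.1 ht p.2, mul_comm]
    exact congrArg (fun q => Q.g t p.1 * e j q) hT.self_of_nhds

/-- The pullback of `N` to `L` has a tautological unit section, with local coordinate `z` relative to
the normalized frame, so the pullback of `N ^ (-a)` is trivialized by `z ^ a`; the powers of the frame
length absorb the absolute values of the transition functions of `N`. -/
theorem IsTrivial.pullback_of_isomorphic_zpow {a : ℤ} (hQ : Q.Isomorphic (N ^ (-a))) :
    (pullback Q h).IsTrivial := by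
  obtain ⟨e, he, h0, hc⟩ := hQ
  refine isTrivial_pullback_iff.2 ⟨fun i p =>
    (p.2 : ℂ) ^ a * (e i p.1 * (h.frameNorm i p.1 : ℂ) ^ (-a)), fun i p => ?_, fun i p => ?_,
    fun i j t x hx z => ?_⟩
  · refine contMDiffAt_mul_complex ?_ (contMDiffAt_mul_complex ?_ ?_)
    · have h1 : ContMDiffAt (I.prod (𝓡 1)) 𝓘(ℝ, ℂ) ∞ (fun q : A.Chart i × Circle => (q.2 : ℂ)) p :=
        ContMDiffAt.comp (g := fun z : Circle => (z : ℂ)) p (contMDiff_circle_coe p.2)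
          contMDiffAt_snd
      exact ContMDiffAt.comp (g := fun v : ℂ => v ^ a) p
        (contDiffAt_zpow_complex a p.2.coe_ne_zero).contMDiffAt h1
    · exact (he i p.1).comp p contMDiffAt_fst
    · exact (h.contMDiff_frameNorm_zpow i (-a) p.1).comp p contMDiffAt_fst
  · exact mul_ne_zero (zpow_ne_zero _ p.2.coe_ne_zero)
      (mul_ne_zero (h0 i p.1) (zpow_ne_zero _ (h.frameNorm_ne_zero i p.1)))
  · have h1 : e j (t.map x) * Q.g t x = N.g t x ^ (-a) * e i x := hc i j t x hx
    have h2 := congrArg (· ^ (-a)) (h.frameNorm_map_mul_g t hx)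
    simp only [mul_zpow] at h2
    have h3 : (phase (N.g t x) : ℂ) ^ a * (phase (N.g t x) : ℂ) ^ (-a) = 1 := by
      rw [← zpow_add₀ (Circle.coe_ne_zero _), add_neg_cancel, zpow_zero]
    dsimp only
    rw [Circle.coe_mul, mul_zpow]
    linear_combination ((phase (N.g t x) : ℂ) ^ a * (z : ℂ) ^ a *
      (h.frameNorm j (t.map x) : ℂ) ^ (-a)) * h1 +
      ((phase (N.g t x) : ℂ) ^ a * (z : ℂ) ^ a * e i x) * h2 +
      ((z : ℂ) ^ a * e i x * (h.frameNorm i x : ℂ) ^ (-a)) * h3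

/-- The fibrewise geometric means of a trivialization of fibrewise degree `a`, corrected by powers of
the frame length, form an isomorphism from `Q` to `N ^ (-a)`. -/
theorem IsTrivial.exists_isomorphic_zpow [PreconnectedSpace D] (hQ : (pullback Q h).IsTrivial) :
    ∃ a : ℤ, Q.Isomorphic (N ^ (-a)) := by
  obtain ⟨e, he, h0, hc⟩ := isTrivial_pullback_iff.1 hQ
  obtain ⟨d, hd⟩ := exists_forall_circleDegree_eq (fun i => (he i).continuous) h0 hc
  have hcont : ∀ i x, Continuous fun z => e i (x, z) := fun i x =>
    (he i).continuous.comp (Continuous.prodMk_right x)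
  refine ⟨d, fun i x => circleGeomMean (fun z => e i (x, z)) * (h.frameNorm i x : ℂ) ^ d,
    fun i x => ?_, fun i x => ?_, fun i j t x hx => ?_⟩
  · exact contMDiffAt_mul_complex (contMDiff_circleGeomMean (he i) (h0 i) x)
      (h.contMDiff_frameNorm_zpow i d x)
  · exact mul_ne_zero (circleGeomMean_ne_zero (hcont i x) fun z => h0 i _)
      (zpow_ne_zero _ (h.frameNorm_ne_zero i x))
  · have h1 := circleGeomMean_mul_rotate (hcont j (t.map x)) (fun z => h0 j _)
      (Q.g_ne_zero t x hx) (phase (N.g t x))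
    rw [funext (hc i j t x hx), hd] at h1
    have h2 := congrArg (· ^ d) (h.frameNorm_map_mul_g t hx)
    simp only [mul_zpow] at h2
    have h3 : N.g t x ^ (-d) * N.g t x ^ d = 1 := by
      rw [← zpow_add₀ (N.g_ne_zero t x hx), neg_add_cancel, zpow_zero]
    change _ = N.g t x ^ (-d) * _
    dsimp only
    rw [h1]
    linear_combination (N.g t x ^ (-d) * Q.g t x *
      circleGeomMean (fun z => e j (t.map x, z))) * h2 -
      (Q.g t x * circleGeomMean (fun z => e j (t.map x, z)) *
        (h.frameNorm j (t.map x) : ℂ) ^ d) * h3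

end Boundaryless

end LineOrbibundle

end

theorem mainTheorem11 {n : ℕ} {D : Type u} [TopologicalSpace D] [PreconnectedSpace D]
    (A : OrbifoldAtlas (𝓡 n) D) (N Q : LineOrbibundle A) (h : N.HermitianMetric) :
    (LineOrbibundle.pullback Q h).IsTrivial ↔ ∃ α : ℤ, Q.Isomorphic (N ^ (-α)) :=
  ⟨fun hQ => hQ.exists_isomorphic_zpow, fun ⟨_, hQ⟩ => .pullback_of_isomorphic_zpow hQ⟩
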